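/- **Theorem 2.17.** *Setting.* Let $E$ be a real vector space of dimension $n-1\equiv 6 \pmod 8$ with a negative definite scalar product $\langle\cdot,\cdot\rangle$, let $\mathfrak m=E\oplus\mathbb Rp\oplus\mathbb Rq$ be the Minkowski space in which $p,q$ are isotropic, orthogonal to $E$, and $\langle p,q\rangle=1$, and write $e^\flat=\langle e,\cdot\rangle\in E^*$. Clifford algebras are taken with the convention $v^2=-\langle v,v\rangle$. Let $b$ be a non-degenerate symmetric bilinear form on $E$ and let $B\in\operatorname{End}(E)$ be given by $b(e,f)=-\langle Be,f\rangle$. Let $\mathfrak{heis}_b=E^*\oplus E\oplus\mathbb Rp$ be the Heisenberg Lie algebra whose only non-trivial brackets are $[e^\flat,f]=b(e,f)p$. Let $S_0$ be a real irreducible $\mathrm{Cl}(E)$-module, let $\omega=e_1\cdots e_{n-1}\in \mathrm{Cl}(E)$ be the volume form of an orthonormal basis of $E$, and let $\mathcal C^\circ\subseteq\operatorname{End}_{\mathbb R}(S_0)$ be the even Schur algebra, i.e. the algebra of endomorphisms commuting with Clifford multiplication by all $e\in E$. Let $S=S_-\oplus S_+=S_0\oplus S_0$ be the $\mathrm{Cl}(\mathfrak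 m)$-module with $$\rho_{\rm spin}(p)=\begin{pmatrix}0&2\sqrt2\\0&0\end{pmatrix},\quad \rho_{\rm spin}(q)=\begin{pmatrix}0&0\\-\tfrac1{\sqrt2}&0\end{pmatrix},\quad \rho_{\rm spin}(e)=\begin{pmatrix}-e&0\\0&e\end{pmatrix}\ (e\in E).$$ A representation $\rho:\mathfrak{heis}_b\to\mathfrak{gl}_{\mathbb R}(S)$ is *spin* if $\rho(e^\flat)=\rho_{\rm spin}(\tfrac14[p,Be])$ for all $e\in E$, i.e. $\rho(e^\flat)=\begin{pmatrix}0&\sqrt2\,Be\\0&0\end{pmatrix}$; it has *non-zero charge* if $\rho(p)\ne0$. For maps $\rho_{11},\rho_{22}:E\to\operatorname{End}_{\mathbb R}(S_0)$, a linear map $\rho_{12}:E\to\operatorname{End}_{\mathbb R}(S_0)$ is $(\rho_{11},\rho_{22})$-*suitable* if $(e,f)\mapsto\rho_{11}(e)\rho_{12}(f)-\rho_{12}(f)\rho_{22}(e)$ is symmetric. *Claim.* The algebra $\mathcal C^\circ$ is isomorphic to $\mathbb H$. Fix any isomorphism of real algebras $\mathbb H\cong\mathcal C^\circ$, through which quaternions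 act on $S_0$. Then every non-zero charge spin representation of $\mathfrak{heis}_b$ on $S$ is given by $$\rho(p)=\sqrt2\begin{pmatrix}0&h_1+h_2\omega\\0&0\end{pmatrix},\qquad \rho(e)=\begin{pmatrix}\rho_{11}(e)&\rho_{12}(e)\\0&\rho_{22}(e)\end{pmatrix}\quad(e\in E),$$ $$\rho_{11}(e)=\tfrac12\big(h_3(e)-h_1e+h_2e\,\omega+h_4(e)\omega\big),\qquad \rho_{22}(e)=\tfrac12\big(h_3(e)+h_1e+h_2e\,\omega-h_4(e)\omega\big),$$ where $h_1,h_2\in\mathbb H$, $h_3,h_4\in\operatorname{Hom}_{\mathbb R}(E,\mathbb H)$, $\rho_{12}\in\operatorname{Hom}_{\mathbb R}(E,\operatorname{End}_{\mathbb R}(S_0))$ is $(\rho_{11},\rho_{22})$-suitable, and, for a sign $\pm$, one of the following holds: 1. $\operatorname{Im}h_2\neq0$; the image $\operatorname{Im}h_3(E)\subseteq\operatorname{Im}\mathbb H$ has dimension at most $1$ or equals $(\operatorname{Im}h_2)^\perp$ (the orthogonal complement in $\operatorname{Im}\mathbb H\cong\mathbb R^3$); and $$h_1=\pm\Big(|\operatorname{Im}h_2|-\operatorname{Re}h_2\,\frac{\operatorname{Im}h_2}{|\operatorname{Im}h_2|}\Big),\qquad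 h_4(e)=\pm\frac{\operatorname{Im}h_2\times\operatorname{Im}h_3(e)}{|\operatorname{Im}h_2|};$$ 2. $\operatorname{Re}h_1=0$, $\operatorname{Im}h_1\ne0$; the image $\operatorname{Im}h_3(E)$ has dimension at most $1$ or equals $(\operatorname{Im}h_1)^\perp$; and $$h_2=\pm|\operatorname{Im}h_1|,\qquad h_4(e)=\mp\frac{\operatorname{Im}h_1\times\operatorname{Im}h_3(e)}{|\operatorname{Im}h_1|}.$$ Conversely, for all such data the formulas above define a non-zero charge spin representation of $\mathfrak{heis}_b$ on $S$. -/

import Mathlib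

open scoped Quaternion

attribute [local instance] LieRing.ofAssociativeRing

noncomputable section

namespace SpinHeis

section Spaces

variable (E : Type*) [NormedAddCommGroup E] [InnerProductSpace ℝ E]

/-- The negative definite scalar product `⟨·,·⟩|_E`: minus the inner product of `E`. -/
def pairing : LinearMap.BilinForm ℝ E := -innerₗ E

variable {E} in
@[simp]
theorem pairing_apply (e f : E) : pairing E e f = -inner ℝ e f := rfl

theorem pairing_nondegenerate : (pairing E).Nondegenerate := by
  constructor
  · intro x hx
    have h := hx x
    rw [pairing_apply, neg_eq_zero] at h
    exact inner_self_eq_zero.mp h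
  · intro x hx
    have h := hx x
    rw [pairing_apply, neg_eq_zero] at h
    exact inner_self_eq_zero.mp h

/-- The Minkowski space `𝔪 = E ⊕ ℝp ⊕ ℝq`; `(e, x, y)` stands for `e + x p + y q`. -/
abbrev Mink : Type _ := E × ℝ × ℝ

/-- The scalar product of `𝔪`, of signature `(+, -, …, -)`: it restricts to `pairing E` on `E`,
`p` and `q` are isotropic and orthogonal to `E`, and `⟨p, q⟩ = 1`. -/
def minkPairing : LinearMap.BilinForm ℝ (Mink E) :=
  LinearMap.mk₂ ℝ (fun v w => pairing E v.1 w.1 + v.2.1 * w.2.2 + v.2.2 * w.2.1)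
    (by intros; simp only [Prod.fst_add, Prod.snd_add, map_add, LinearMap.add_apply]; ring)
    (by intros; simp only [Prod.smul_fst, Prod.smul_snd, map_smul, LinearMap.smul_apply,
          smul_eq_mul]; ring)
    (by intros; simp only [Prod.fst_add, Prod.snd_add, map_add]; ring)
    (by intros; simp only [Prod.smul_fst, Prod.smul_snd, map_smul, smul_eq_mul]; ring)

variable {E} in
@[simp]
theorem minkPairing_apply (v w : Mink E) :
    minkPairing E v w = pairing E v.1 w.1 + v.2.1 * w.2.2 + v.2.2 * w.2.1 := rfl

/-- The quadratic form `v ↦ -⟨v, v⟩` on `E`. The sign convention of the Clifford algebras is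
`v² = -⟨v, v⟩`, so the vectors of an orthonormal basis of `E` square to `+1`. -/
def euclForm : QuadraticForm ℝ E := -(pairing E).toQuadraticMap

/-- The quadratic form `v ↦ -⟨v, v⟩` on `𝔪`. -/
def minkForm : QuadraticForm ℝ (Mink E) := -(minkPairing E).toQuadraticMap

/-- `Cl(E) = Cl_{0,n-1}`. -/
abbrev ClE : Type _ := CliffordAlgebra (euclForm E)

/-- `Cl(𝔪) = Cl_{1,n}`. -/
abbrev ClM : Type _ := CliffordAlgebra (minkForm E)

variable {E}

/-- The vector `p` of `𝔪`. -/
def vecP : Mink E := (0, 1, 0)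

/-- The vector `e ∈ E` in `𝔪`. -/
def vecE (e : E) : Mink E := (e, 0, 0)

/-- The image `¼[v, w]` of `v ∧ w = ⟨v,·⟩w - ⟨w,·⟩v ∈ 𝔰𝔬(𝔪)` under the embedding
`𝔰𝔬(𝔪) ↪ Cl(𝔪)`. -/
def wedge (v w : Mink E) : ClM E :=
  (1 / 4 : ℝ) • (CliffordAlgebra.ι (minkForm E) v * CliffordAlgebra.ι (minkForm E) w
    - CliffordAlgebra.ι (minkForm E) w * CliffordAlgebra.ι (minkForm E) v)

/-- The volume form `e₁ ⋯ e_m ∈ Cl(E)` of an orthonormal basis (ordered product). -/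
def volumeForm {m : ℕ} (ε : OrthonormalBasis (Fin m) ℝ E) : ClE E :=
  (List.ofFn fun i => CliffordAlgebra.ι (euclForm E) (ε i)).prod

end Spaces

section Heisenberg

variable {E : Type*} [NormedAddCommGroup E] [InnerProductSpace ℝ E]

/-- The musical isomorphism `e ↦ e^♭ = ⟨e, ·⟩|_E`. -/
def flat [FiniteDimensional ℝ E] : E ≃ₗ[ℝ] Module.Dual ℝ E :=
  (pairing E).toDual (pairing_nondegenerate E)

/-- The endomorphism `B` of `E` defined by `b(e, f) = -⟨B e, f⟩`. -/
def opB [FiniteDimensional ℝ E] (b : LinearMap.BilinForm ℝ E) : E →ₗ[ℝ] E := -(flat.symm.toLinearMap ∘ₗ b)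

theorem opB_spec [FiniteDimensional ℝ E] (b : LinearMap.BilinForm ℝ E) (e f : E) :
    b e f = -pairing E (opB b e) f := by
  have h : flat (opB b e) = -b e := by simp [opB]
  have h' : pairing E (opB b e) f = flat (opB b e) f := rfl
  rw [h', h]
  simp

/-- The underlying space `E^* ⊕ E ⊕ ℝp` of the Heisenberg algebra `𝔥𝔢𝔦𝔰_b`. -/
@[ext]
structure Heis (b : LinearMap.BilinForm ℝ E) where
  /-- the component in `E^*` -/
  dual : Module.Dual ℝ E
  /-- the component in `E` -/
  vec : E
  /-- the coefficient of `p` -/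
  ctr : ℝ

namespace Heis

variable {b : LinearMap.BilinForm ℝ E}

/-- The identification with the product that transports the vector space structure. -/
def equivProd (b : LinearMap.BilinForm ℝ E) : Heis b ≃ Module.Dual ℝ E × E × ℝ where
  toFun x := (x.dual, x.vec, x.ctr)
  invFun x := ⟨x.1, x.2.1, x.2.2⟩
  left_inv _ := rfl
  right_inv _ := rfl

instance : AddCommGroup (Heis b) := (equivProd b).addCommGroup

instance : Module ℝ (Heis b) := (equivProd b).module ℝ

@[simp] theorem dual_add (x y : Heis b) : (x + y).dual = x.dual + y.dual := rfl
@[simp] theorem vec_add (x y : Heis b) : (x + y).vec = x.vec + y.vec := rfl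
@[simp] theorem ctr_add (x y : Heis b) : (x + y).ctr = x.ctr + y.ctr := rfl
@[simp] theorem dual_zero : (0 : Heis b).dual = 0 := rfl
@[simp] theorem vec_zero : (0 : Heis b).vec = 0 := rfl
@[simp] theorem ctr_zero : (0 : Heis b).ctr = 0 := rfl
@[simp] theorem dual_smul (r : ℝ) (x : Heis b) : (r • x).dual = r • x.dual := rfl
@[simp] theorem vec_smul (r : ℝ) (x : Heis b) : (r • x).vec = r • x.vec := rfl
@[simp] theorem ctr_smul (r : ℝ) (x : Heis b) : (r • x).ctr = r * x.ctr := rfl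

variable [FiniteDimensional ℝ E]

/-- The bracket, whose only non-trivial values on the summands are
`[e^♭, f] = b(e, f) p = -[f, e^♭]`. -/
instance : Bracket (Heis b) (Heis b) where
  bracket x y := ⟨0, 0, b (flat.symm x.dual) y.vec - b (flat.symm y.dual) x.vec⟩

@[simp] theorem dual_lie (x y : Heis b) : ⁅x, y⁆.dual = 0 := rfl
@[simp] theorem vec_lie (x y : Heis b) : ⁅x, y⁆.vec = 0 := rfl
@[simp] theorem ctr_lie (x y : Heis b) :
    ⁅x, y⁆.ctr = b (flat.symm x.dual) y.vec - b (flat.symm y.dual) x.vec := rfl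

instance : LieRing (Heis b) where
  add_lie x y z := by
    ext <;> simp
    ring
  lie_add x y z := by
    ext <;> simp
    ring
  lie_self x := by
    ext <;> simp
  leibniz_lie x y z := by
    ext <;> simp

instance : LieAlgebra ℝ (Heis b) where
  lie_smul r x y := by
    ext <;> simp
    ring

/-- The element `e^♭` of `E^* ⊆ 𝔥𝔢𝔦𝔰_b`. -/
def ofFlat (b : LinearMap.BilinForm ℝ E) (e : E) : Heis b := ⟨flat e, 0, 0⟩

/-- The element `e` of `E ⊆ 𝔥𝔢𝔦𝔰_b`. -/
def ofVec (b : LinearMap.BilinForm ℝ E) (e : E) : Heis b := ⟨0, e, 0⟩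

/-- The central element `p` of `𝔥𝔢𝔦𝔰_b`. -/
def p (b : LinearMap.BilinForm ℝ E) : Heis b := ⟨0, 0, 1⟩

end Heis

end Heisenberg

section Spinors

/-- The endomorphism of `S₀ ⊕ S₀ = S₋ ⊕ S₊` with block matrix `(a₁₁ a₁₂; a₂₁ a₂₂)`, acting on
columns `(Q₋, Q₊)`. -/
def block {S₀ : Type*} [AddCommGroup S₀] [Module ℝ S₀] (a₁₁ a₁₂ a₂₁ a₂₂ : Module.End ℝ S₀) :
    Module.End ℝ (S₀ × S₀) :=
  LinearMap.prod (LinearMap.coprod a₁₁ a₁₂) (LinearMap.coprod a₂₁ a₂₂)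

variable {E : Type*} [NormedAddCommGroup E] [InnerProductSpace ℝ E]
variable (S₀ : Type*) [AddCommGroup S₀] [Module ℝ S₀] [Module (ClE E) S₀]
  [IsScalarTower ℝ (ClE E) S₀]

/-- The action `ρ_{0,n-1} : Cl(E) → End_ℝ(S₀)`. -/
def cl : ClE E →ₐ[ℝ] Module.End ℝ S₀ := Algebra.lsmul ℝ ℝ S₀

/-- Clifford multiplication of spinors by vectors of `E`. -/
def clMul : E →ₗ[ℝ] Module.End ℝ S₀ :=
  (cl S₀).toLinearMap ∘ₗ CliffordAlgebra.ι (euclForm E)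

theorem clMul_clMul (e : E) (s : S₀) :
    clMul S₀ e (clMul S₀ e s) = euclForm E e • s := by
  change CliffordAlgebra.ι (euclForm E) e • CliffordAlgebra.ι (euclForm E) e • s = _
  rw [smul_smul, CliffordAlgebra.ι_sq_scalar, algebraMap_smul]

variable (E) in
/-- The even Schur algebra `𝒞°`: the endomorphisms of `S₀` (automatically `𝔰𝔬(E)`-invariant) that
commute with the Clifford multiplication by every vector. -/
def evenSchur : Subalgebra ℝ (Module.End ℝ S₀) :=
  Subalgebra.centralizer ℝ (Set.range (clMul S₀ : E →ₗ[ℝ] Module.End ℝ S₀))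

/-- The action on `S = S_{1,1} ⊗ S₀ = S₋ ⊕ S₊` of the vector `e + x p + y q` of `𝔪`:
`p ↦ (0 2√2; 0 0)`, `q ↦ (0 0; -1/√2 0)`, `e ↦ (-e 0; 0 e)`. -/
def spinVec : Mink E →ₗ[ℝ] Module.End ℝ (S₀ × S₀) where
  toFun v := block (-clMul S₀ v.1) ((2 * √2 * v.2.1) • 1) ((-(1 / √2) * v.2.2) • 1) (clMul S₀ v.1)
  map_add' v w := by
    ext s <;> simp [block, add_smul, mul_add]
    all_goals abel
  map_smul' r v := by
    ext s <;> simp [block, mul_smul, mul_left_comm _ r]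

theorem spinVec_sq (v : Mink E) :
    spinVec S₀ v * spinVec S₀ v = algebraMap ℝ _ (minkForm E v) := by
  have h2 : √2 * (√2)⁻¹ = 1 := mul_inv_cancel₀ (by positivity)
  have hQ : minkForm E v = euclForm E v.1 - 2 * (v.2.1 * v.2.2) := by
    simp [minkForm, euclForm]; ring
  have h3 : (2 * √2 * v.2.1) * (-(1 / √2) * v.2.2) = -(2 * (v.2.1 * v.2.2)) := by
    rw [one_div]; linear_combination (-2 * v.2.1 * v.2.2) * h2
  have h4 : (-(1 / √2) * v.2.2) * (2 * √2 * v.2.1) = -(2 * (v.2.1 * v.2.2)) := by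
    rw [mul_comm, h3]
  refine LinearMap.ext fun s => ?_
  rw [hQ]
  refine Prod.ext ?_ ?_
  · change -(clMul S₀ v.1 (-(clMul S₀ v.1 s.1) + (2 * √2 * v.2.1) • s.2))
        + (2 * √2 * v.2.1) • ((-(1 / √2) * v.2.2) • s.1 + clMul S₀ v.1 s.2)
      = (euclForm E v.1 - 2 * (v.2.1 * v.2.2)) • s.1
    rw [map_add, map_neg, clMul_clMul, map_smul, smul_add, smul_smul, h3, sub_smul, neg_smul]
    abel
  · change (-(1 / √2) * v.2.2) • (-(clMul S₀ v.1 s.1) + (2 * √2 * v.2.1) • s.2)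
        + clMul S₀ v.1 ((-(1 / √2) * v.2.2) • s.1 + clMul S₀ v.1 s.2)
      = (euclForm E v.1 - 2 * (v.2.1 * v.2.2)) • s.2
    rw [map_add, map_smul, clMul_clMul, smul_add, smul_smul, h4, sub_smul, neg_smul, smul_neg]
    abel

/-- The spin representation `ρ_spin : Cl(𝔪) → End_ℝ(S)` on `S = S_{1,1} ⊗ S₀ = S₋ ⊕ S₊`. -/
def rhoSpin : ClM E →ₐ[ℝ] Module.End ℝ (S₀ × S₀) :=
  CliffordAlgebra.lift (minkForm E) ⟨spinVec S₀, spinVec_sq S₀⟩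

variable {S₀}
variable [FiniteDimensional ℝ E]

/-- A representation `ρ` of `𝔥𝔢𝔦𝔰_b` on `S` is spin if its restriction to `E^*` is `ρ_spin ∘ 𝔦_b`,
where `𝔦_b(e^♭) = p ∧ B e` is the isotropy representation. -/
def IsSpin {b : LinearMap.BilinForm ℝ E} (ρ : Heis b →ₗ⁅ℝ⁆ Module.End ℝ (S₀ × S₀)) : Prop :=
  ∀ e : E, ρ (Heis.ofFlat b e) = rhoSpin S₀ (wedge vecP (vecE (opB b e)))

end Spinors

section Suitable

/-- `ρ₁₂` is `(ρ₁₁, ρ₂₂)`-suitable: the bilinear map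
`(e, f) ↦ ρ₁₁(e) ρ₁₂(f) - ρ₁₂(f) ρ₂₂(e)` is symmetric. -/
def Suitable {E S₀ : Type*} [AddCommGroup E] [Module ℝ E] [AddCommGroup S₀] [Module ℝ S₀]
    (ρ₁₁ ρ₂₂ : E → Module.End ℝ S₀) (ρ₁₂ : E →ₗ[ℝ] Module.End ℝ S₀) : Prop :=
  ∀ e f : E, ρ₁₁ e * ρ₁₂ f - ρ₁₂ f * ρ₂₂ e = ρ₁₁ f * ρ₁₂ e - ρ₁₂ e * ρ₂₂ f

end Suitable

section Quaternions

/-- The cross product `Im a × Im b`, as an imaginary quaternion. -/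
def imCross (a b : ℍ[ℝ]) : ℍ[ℝ] :=
  ⟨0, a.imJ * b.imK - a.imK * b.imJ, a.imK * b.imI - a.imI * b.imK,
    a.imI * b.imJ - a.imJ * b.imI⟩

/-- The map `h ↦ Im h`. -/
def imLin : ℍ[ℝ] →ₗ[ℝ] ℍ[ℝ] where
  toFun h := h.im
  map_add' _ _ := by simp
  map_smul' _ _ := by simp

/-- The orthogonal complement of `Im h` in `Im ℍ ≅ ℝ³`. -/
def imPerp (h : ℍ[ℝ]) : Submodule ℝ ℍ[ℝ] where
  carrier := {v | v.re = 0 ∧ inner ℝ h.im v = 0}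
  zero_mem' := by simp
  add_mem' := by
    rintro v w ⟨hv, hv'⟩ ⟨hw, hw'⟩
    exact ⟨by simp [hv, hw], by rw [inner_add_right, hv', hw', add_zero]⟩
  smul_mem' := by
    rintro r v ⟨hv, hv'⟩
    exact ⟨by simp [hv], by rw [inner_smul_right, hv', mul_zero]⟩

variable {E : Type*} [AddCommGroup E] [Module ℝ E]

/-- The condition on `Im h₃ : E → Im ℍ` relative to a quaternion `h`: either `Im h₃` has rank at
most `1` or its image is `(Im h)^⊥`. -/
def ImCondition (h : ℍ[ℝ]) (h₃ : E →ₗ[ℝ] ℍ[ℝ]) : Prop :=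
  Module.finrank ℝ (LinearMap.range (imLin ∘ₗ h₃)) ≤ 1 ∨ LinearMap.range (imLin ∘ₗ h₃) = imPerp h

/-- The first family of parameters, with sign `s = ±1`. -/
def FirstFamily (s : ℝ) (h₁ h₂ : ℍ[ℝ]) (h₃ h₄ : E →ₗ[ℝ] ℍ[ℝ]) : Prop :=
  h₂.im ≠ 0 ∧ ImCondition h₂ h₃ ∧
  h₁ = s • ((‖h₂.im‖ : ℍ[ℝ]) - (h₂.re / ‖h₂.im‖) • h₂.im) ∧
  ∀ e, h₄ e = (s / ‖h₂.im‖) • imCross h₂ (h₃ e)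

/-- The second family of parameters, with sign `s = ±1`. -/
def SecondFamily (s : ℝ) (h₁ h₂ : ℍ[ℝ]) (h₃ h₄ : E →ₗ[ℝ] ℍ[ℝ]) : Prop :=
  h₁.re = 0 ∧ h₁.im ≠ 0 ∧ ImCondition h₁ h₃ ∧
  h₂ = s • (‖h₁.im‖ : ℍ[ℝ]) ∧
  ∀ e, h₄ e = (-s / ‖h₁.im‖) • imCross h₁ (h₃ e)

/-- The parameters of the non-zero charge representations: one of the two families. -/
def IsParameter (h₁ h₂ : ℍ[ℝ]) (h₃ h₄ : E →ₗ[ℝ] ℍ[ℝ]) : Prop :=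
  ∃ s : ℝ, (s = 1 ∨ s = -1) ∧ (FirstFamily s h₁ h₂ h₃ h₄ ∨ SecondFamily s h₁ h₂ h₃ h₄)

end Quaternions

section Formulas

variable {E : Type*} [NormedAddCommGroup E] [InnerProductSpace ℝ E]
variable {S₀ : Type*} [AddCommGroup S₀] [Module ℝ S₀] [Module (ClE E) S₀]
  [IsScalarTower ℝ (ClE E) S₀]

/-- The action of quaternions on `S₀` through an identification `Φ : ℍ ≅ 𝒞°`. -/
def qAct (Φ : ℍ[ℝ] ≃ₐ[ℝ] evenSchur E S₀) : ℍ[ℝ] →ₐ[ℝ] Module.End ℝ S₀ :=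
  (evenSchur E S₀).val.comp Φ.toAlgHom

/-- `ρ₁₁(e) = ½ (h₃(e) Id - h₁ e + h₂ e ω + h₄(e) ω)`, where quaternions act through
`Φ : ℍ ≅ 𝒞°`. -/
def rho11 (Φ : ℍ[ℝ] ≃ₐ[ℝ] evenSchur E S₀) (ω : ClE E) (h₁ h₂ : ℍ[ℝ]) (h₃ h₄ : E →ₗ[ℝ] ℍ[ℝ])
    (e : E) : Module.End ℝ S₀ :=
  (1 / 2 : ℝ) • (qAct Φ (h₃ e) - qAct Φ h₁ * clMul S₀ e
    + qAct Φ h₂ * clMul S₀ e * cl S₀ ω + qAct Φ (h₄ e) * cl S₀ ω)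

/-- `ρ₂₂(e) = ½ (h₃(e) Id + h₁ e + h₂ e ω - h₄(e) ω)`. -/
def rho22 (Φ : ℍ[ℝ] ≃ₐ[ℝ] evenSchur E S₀) (ω : ClE E) (h₁ h₂ : ℍ[ℝ]) (h₃ h₄ : E →ₗ[ℝ] ℍ[ℝ])
    (e : E) : Module.End ℝ S₀ :=
  (1 / 2 : ℝ) • (qAct Φ (h₃ e) + qAct Φ h₁ * clMul S₀ e
    + qAct Φ h₂ * clMul S₀ e * cl S₀ ω - qAct Φ (h₄ e) * cl S₀ ω)

/-- `ρ(p) = √2 (0 h₁ Id + h₂ ω; 0 0)` and `ρ(e) = (ρ₁₁(e) ρ₁₂(e); 0 ρ₂₂(e))`. -/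
def IsGivenBy [FiniteDimensional ℝ E] {b : LinearMap.BilinForm ℝ E}
    (ρ : Heis b →ₗ⁅ℝ⁆ Module.End ℝ (S₀ × S₀)) (Φ : ℍ[ℝ] ≃ₐ[ℝ] evenSchur E S₀) (ω : ClE E)
    (h₁ h₂ : ℍ[ℝ]) (h₃ h₄ : E →ₗ[ℝ] ℍ[ℝ]) (ρ₁₂ : E →ₗ[ℝ] Module.End ℝ S₀) : Prop :=
  ρ (Heis.p b) = √2 • block 0 (qAct Φ h₁ + qAct Φ h₂ * cl S₀ ω) 0 0 ∧
  ∀ e : E, ρ (Heis.ofVec b e) =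
    block (rho11 Φ ω h₁ h₂ h₃ h₄ e) (ρ₁₂ e) 0 (rho22 Φ ω h₁ h₂ h₃ h₄ e)

end Formulas

end SpinHeis

end

/-! The even Schur algebra is identified by a trace count. An invariant scalar product makes
Clifford multiplication by an orthonormal basis a family of `m` symmetric `N × N` matrices. The
average `P` over conjugations by these matrices (`conjAverage`) projects onto their centralizer,
whose dimension is therefore `tr P = N² / 2^m`. By simplicity and the spectral theorem, only scalars
are symmetric in the centralizer, so averaging `P` with its composite with transposition gives a
projection onto a line. Its trace is 1, and the signs of the squared Clifford monomials turn this
into a quadratic equation for `N`; when `m ≡ 6 mod 8` it forces dimension 4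
(`finrank_centralizer_eq_four`). Skew elements then square to negative scalars, which produces
quaternion units (`nonempty_quaternion_equiv`).

For the classification, write the spin condition in blocks. The bracket of `e^♭` with `f` and
invertibility of `B` kill the lower left block and give `e d(f) - a(f) e = ⟨e, f⟩ Z` for the
diagonal blocks `a`, `d`, with the Euclidean inner product (`IsSpin.block_relations`). For fixed `f`
this says that `a(f)` and `d(f)` are intertwined by every vector orthogonal to `f`. Averaging and
Schur's lemma then write both as quaternionic combinations of `1, f, ω, fω` (`exists_eq_diag`). The
coefficients are the four parameters.

What remains is that the elements of `E` commute. The upper right block of this relation is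
suitability. In the diagonal blocks, `1, e, f, ef` are independent over the algebra generated by
quaternions and `ω` (`cx_independent`), so commutation is equivalent to equations between
quaternions (`IsQuaternionSolution`). These are vector algebra in three dimensions: `h₁² + h₂² = 0`
with `h₁, h₂` commuting fixes the pair up to a sign, `h₄` becomes a rotation of `h₃` about an axis,
and the remaining relations say that cross products of values of `Im h₃` are parallel to that axis
(`imCondition_iff`). The same equations make the commutators vanish in the converse direction
(`blockRep`). -/

noncomputable section

namespace SpinHeis

/-! ### Clifford families, their monomials, and averaging over conjugations -/

section CliffordFamilies

variable {R ι : Type*} [Ring R]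

/-- A family of pairwise anticommuting involutions of a ring. -/
structure IsCliffordFamily (γ : ι → R) : Prop where
  sq : ∀ i, γ i * γ i = 1
  anticomm : ∀ i j, i ≠ j → γ i * γ j = -(γ j * γ i)

/-- The ordered product of the members of a family along a list of indices. -/
def monomial (γ : ι → R) (L : List ι) : R := (L.map γ).prod

@[simp] theorem monomial_nil (γ : ι → R) : monomial γ [] = 1 := rfl

@[simp] theorem monomial_cons (γ : ι → R) (j : ι) (L : List ι) :
    monomial γ (j :: L) = γ j * monomial γ L := by simp [monomial]

theorem monomial_append (γ : ι → R) (K L : List ι) :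
    monomial γ (K ++ L) = monomial γ K * monomial γ L := by simp [monomial]

namespace IsCliffordFamily

variable {γ : ι → R}

/-- Anticommuting on both sides of `x` produces two signs, which cancel. -/
theorem conj_conj_comm (hγ : IsCliffordFamily γ) (i j : ι) (x : R) :
    γ i * (γ j * x * γ j) * γ i = γ j * (γ i * x * γ i) * γ j := by
  rcases eq_or_ne i j with rfl | h
  · rfl
  · have h1 := hγ.anticomm i j h
    have h2 := hγ.anticomm j i h.symm
    calc γ i * (γ j * x * γ j) * γ i = (γ i * γ j) * x * (γ j * γ i) := by noncomm_ring
      _ = (γ j * γ i) * x * (γ i * γ j) := by rw [h1, h2]; noncomm_ring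
      _ = _ := by noncomm_ring

theorem commute_of_conj_eq (hγ : IsCliffordFamily γ) {i : ι} {x : R} (h : γ i * x * γ i = x) :
    γ i * x = x * γ i := by
  calc γ i * x = γ i * (γ i * x * γ i) := by rw [h]
    _ = (γ i * γ i) * x * γ i := by noncomm_ring
    _ = _ := by rw [hγ.sq, one_mul]

theorem conj_eq_of_commute (hγ : IsCliffordFamily γ) {i : ι} {x : R} (h : γ i * x = x * γ i) :
    γ i * x * γ i = x := by
  rw [h, mul_assoc, hγ.sq, mul_one]

variable [Algebra ℝ R]

theorem mul_monomial_of_notMem (hγ : IsCliffordFamily γ) {j : ι} {L : List ι} (h : j ∉ L) :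
    γ j * monomial γ L = (-1 : ℝ) ^ L.length • (monomial γ L * γ j) := by
  induction L with
  | nil => simp
  | cons i L ih =>
    rw [List.mem_cons, not_or] at h
    rw [monomial_cons, ← mul_assoc, hγ.anticomm j i h.1, neg_mul, mul_assoc, ih h.2,
      List.length_cons, pow_succ, mul_smul_comm, mul_assoc]
    simp

theorem mul_monomial_of_mem (hγ : IsCliffordFamily γ) {j : ι} {L : List ι} (hL : L.Nodup)
    (h : j ∈ L) :
    γ j * monomial γ L = (-1 : ℝ) ^ (L.length + 1) • (monomial γ L * γ j) := by
  induction L with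
  | nil => simp at h
  | cons i L ih =>
    rw [List.nodup_cons] at hL
    rw [monomial_cons, List.length_cons]
    by_cases hij : j = i
    · subst hij
      have h1 := hγ.mul_monomial_of_notMem hL.1
      rw [mul_assoc, ← mul_assoc (γ j) (γ j), hγ.sq, one_mul]
      have h2 : γ j * (monomial γ L * γ j) = (-1 : ℝ) ^ L.length • monomial γ L := by
        rw [← mul_assoc, h1, smul_mul_assoc, mul_assoc, hγ.sq, mul_one]
      rw [h2, smul_smul, ← pow_add, show L.length + 1 + 1 + L.length = 2 * (L.length + 1) by ring,
        pow_mul]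
      simp
    · have hjL : j ∈ L := by simpa [hij] using h
      rw [← mul_assoc, hγ.anticomm j i hij, neg_mul, mul_assoc, ih hL.2 hjL,
        pow_succ _ (L.length + 1), mul_smul_comm, mul_assoc]
      simp

/-- Moving a first factor past the `k` others costs `k` signs; summing over the factors gives the
binomial exponent. -/
theorem monomial_mul_self (hγ : IsCliffordFamily γ) {L : List ι} (hL : L.Nodup) :
    monomial γ L * monomial γ L = (-1 : ℝ) ^ (L.length.choose 2) • 1 := by
  induction L with
  | nil => simp
  | cons i L ih =>
    rw [List.nodup_cons] at hL
    have h1 := hγ.mul_monomial_of_notMem hL.1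
    have h2 : monomial γ L * γ i = (-1 : ℝ) ^ L.length • (γ i * monomial γ L) := by
      rw [h1, smul_smul, ← pow_add, ← two_mul, pow_mul]; simp
    calc monomial γ (i :: L) * monomial γ (i :: L)
        = γ i * (monomial γ L * γ i) * monomial γ L := by simp [mul_assoc]
      _ = (-1 : ℝ) ^ L.length • ((γ i * γ i) * (monomial γ L * monomial γ L)) := by
          rw [h2]; simp [mul_assoc]
      _ = _ := by
          rw [hγ.sq, ih hL.2, one_mul, smul_smul, ← pow_add, List.length_cons,
            Nat.choose_succ_succ' L.length 1, Nat.choose_one_right]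

end IsCliffordFamily

variable [Algebra ℝ R]

/-- The composition, over the indices `j` of a list, of the averages of `x` and its conjugate by
`γ j`. -/
def conjAverage (γ : ι → R) : List ι → (R →ₗ[ℝ] R)
  | [] => LinearMap.id
  | j :: L => (1 / 2 : ℝ) • (conjAverage γ L +
      (LinearMap.mulLeft ℝ (γ j) ∘ₗ LinearMap.mulRight ℝ (γ j)) ∘ₗ conjAverage γ L)

@[simp] theorem conjAverage_nil (γ : ι → R) (x : R) : conjAverage γ [] x = x := rfl

theorem conjAverage_cons (γ : ι → R) (j : ι) (L : List ι) (x : R) :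
    conjAverage γ (j :: L) x
      = (1 / 2 : ℝ) • (conjAverage γ L x + γ j * conjAverage γ L x * γ j) := by
  simp [conjAverage, mul_assoc]

/-- Expanding the iterated average into two-sided multiplications makes its trace computable. Nested
conjugations put the right-hand factors in the opposite order, hence the reversed list. -/
theorem conjAverage_eq_sum (γ : ι → R) (L : List ι) (x : R) :
    conjAverage γ L x = (1 / 2 : ℝ) ^ L.length •
      (L.sublists'.map fun K => monomial γ K * x * monomial γ K.reverse).sum := by
  induction L with
  | nil => simp
  | cons j L ih =>
    have h : ∀ M : List (List ι),
        γ j * (M.map fun K => monomial γ K * x * monomial γ K.reverse).sum * γ j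
          = (M.map fun K => monomial γ (j :: K) * x * monomial γ (j :: K).reverse).sum := by
      intro M
      induction M with
      | nil => simp
      | cons K M ihM =>
        rw [List.map_cons, List.sum_cons, List.map_cons, List.sum_cons, ← ihM, mul_add, add_mul,
          List.reverse_cons, monomial_append, monomial_cons, monomial_cons, monomial_nil, mul_one]
        noncomm_ring
    rw [conjAverage_cons, ih, List.sublists'_cons, List.map_append, List.sum_append,
      List.length_cons, pow_succ', mul_smul, smul_add (_ ^ _), mul_smul_comm, smul_mul_assoc, h,
      List.map_map]
    rfl

namespace IsCliffordFamily

variable {γ : ι → R}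

theorem conjAverage_eq_self (hγ : IsCliffordFamily γ) {L : List ι} {x : R}
    (h : ∀ i ∈ L, γ i * x = x * γ i) : conjAverage γ L x = x := by
  induction L with
  | nil => rfl
  | cons j L ih =>
    rw [conjAverage_cons, ih fun i hi => h i (List.mem_cons_of_mem _ hi),
      hγ.conj_eq_of_commute (h j List.mem_cons_self), ← two_smul ℝ, smul_smul]
    norm_num

/-- Conjugation by `γ i` is an involution, so it swaps the two terms of its own average; it passes
through the other averages because conjugations commute. -/
theorem conj_conjAverage (hγ : IsCliffordFamily γ) {L : List ι} {i : ι} (hi : i ∈ L) (x : R) :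
    γ i * conjAverage γ L x * γ i = conjAverage γ L x := by
  induction L with
  | nil => simp at hi
  | cons j L ih =>
    rw [conjAverage_cons, mul_smul_comm, smul_mul_assoc, mul_add, add_mul]
    congr 1
    rcases List.mem_cons.mp hi with rfl | hi
    · rw [add_comm]
      congr 1
      calc γ i * (γ i * conjAverage γ L x * γ i) * γ i
          = (γ i * γ i) * conjAverage γ L x * (γ i * γ i) := by noncomm_ring
        _ = _ := by rw [hγ.sq, one_mul, mul_one]
    · rw [hγ.conj_conj_comm, ih hi]

theorem commute_conjAverage (hγ : IsCliffordFamily γ) {L : List ι} {i : ι} (hi : i ∈ L) (x : R) :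
    γ i * conjAverage γ L x = conjAverage γ L x * γ i :=
  hγ.commute_of_conj_eq (hγ.conj_conjAverage hi x)

end IsCliffordFamily

end CliffordFamilies

/-! ### Signed counts of sublists -/

section SignSums

/-- The sum of `f |K|` over the sublists `K` of a list, for an alternating-by-twos `f`. -/
theorem sum_sublists_add_two {α : Type*} {f : ℕ → ℝ} (hf : ∀ k, f (k + 2) = -f k)
    (a b : α) (L : List α) :
    ((a :: b :: L).sublists'.map fun K => f K.length).sum
      = 2 * (L.sublists'.map fun K => f (K.length + 1)).sum := by
  -- Sublists with neither or both of `a`, `b` cancel in pairs; those with exactly one contribute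
  -- twice.
  simp only [List.sublists'_cons, List.map_append, List.sum_append, List.map_map,
    Function.comp_def, List.length_cons, add_assoc, Nat.reduceAdd, hf]
  simp only [← List.sum_map_add, ← List.sum_map_mul_left]
  congr 2
  ext K
  ring

theorem sum_sublists_add_four {α : Type*} {f : ℕ → ℝ} (hf : ∀ k, f (k + 2) = -f k)
    (a b c d : α) (L : List α) :
    ((a :: b :: c :: d :: L).sublists'.map fun K => f K.length).sum
      = -4 * (L.sublists'.map fun K => f K.length).sum := by
  rw [sum_sublists_add_two hf, sum_sublists_add_two (f := fun k => f (k + 1)) fun k => hf (k + 1)]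
  simp only [add_assoc, Nat.reduceAdd, hf, ← List.sum_map_mul_left]
  congr 2
  ext K
  ring

/-- Four further entries multiply the sum by `-4`, so eight multiply it by `16`. For six entries,
`-4` times the value `2 f 1` for two entries remains. -/
theorem sum_sublists_of_length {α : Type*} {f : ℕ → ℝ} (hf : ∀ k, f (k + 2) = -f k) (t : ℕ)
    (L : List α) (hL : L.length = 8 * t + 6) :
    (L.sublists'.map fun K => f K.length).sum = -8 * 16 ^ t * f 1 := by
  induction t generalizing L with
  | zero =>
    obtain ⟨a, b, c, d, L, rfl⟩ : ∃ a b c d L', L = a :: b :: c :: d :: L' := by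
      match L, hL with
      | a :: b :: c :: d :: L, _ => exact ⟨a, b, c, d, L, rfl⟩
    rw [sum_sublists_add_four hf]
    have hL : L.length = 2 := by simpa using hL
    match L, hL with
    | [a, b], _ =>
      rw [sum_sublists_add_two hf]
      simp
      ring
  | succ t ih =>
    match L, hL with
    | a :: b :: c :: d :: e :: f :: g :: h :: L, hL =>
      rw [sum_sublists_add_four hf, sum_sublists_add_four hf,
        ih L (by simp only [List.length_cons] at hL; omega)]
      ring

theorem neg_one_pow_choose_two_add_two (k : ℕ) :
    (-1 : ℝ) ^ ((k + 2).choose 2) = -(-1) ^ (k.choose 2) := by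
  rw [Nat.choose_succ_succ' (k + 1) 1, Nat.choose_succ_succ' k 1, Nat.choose_one_right,
    Nat.choose_one_right, show k + 1 + (k + k.choose 2) = 2 * k + (k.choose 2 + 1) by ring,
    pow_add, pow_mul, pow_succ _ (k.choose 2)]
  simp

end SignSums


/-! ### Traces of linear maps on matrix spaces -/

section MatrixTraces

variable {n : Type*} [Fintype n] [DecidableEq n]

theorem trace_end_matrix (T : Matrix n n ℝ →ₗ[ℝ] Matrix n n ℝ) :
    LinearMap.trace ℝ _ T = ∑ i, ∑ j, T (Matrix.single i j 1) i j := by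
  rw [LinearMap.trace_eq_matrix_trace ℝ (Matrix.stdBasis ℝ n n), Matrix.trace,
    Fintype.sum_prod_type]
  refine Finset.sum_congr rfl fun i _ => Finset.sum_congr rfl fun j _ => ?_
  rw [Matrix.diag_apply, LinearMap.toMatrix_apply, Matrix.stdBasis_eq_single]
  simp [Matrix.stdBasis]

theorem trace_end_of_apply_eq_mul {T : Matrix n n ℝ →ₗ[ℝ] Matrix n n ℝ} {A B : Matrix n n ℝ}
    (hT : ∀ X, T X = A * X * B) : LinearMap.trace ℝ _ T = A.trace * B.trace := by
  rw [trace_end_matrix, Matrix.trace, Matrix.trace, Finset.sum_mul_sum]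
  refine Finset.sum_congr rfl fun i _ => Finset.sum_congr rfl fun j _ => ?_
  rw [hT]
  simp [Matrix.mul_apply, Matrix.single_apply, Finset.sum_ite_eq, ite_and, Matrix.diag_apply]

/-- The coefficient of the elementary matrix at `(i, j)` in its own image is `A i j * B i j`. -/
theorem trace_end_of_apply_eq_mul_transpose {T : Matrix n n ℝ →ₗ[ℝ] Matrix n n ℝ}
    {A B : Matrix n n ℝ} (hT : ∀ X, T X = A * X.transpose * B) :
    LinearMap.trace ℝ _ T = (A * B.transpose).trace := by
  rw [trace_end_matrix, Matrix.trace]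
  refine Finset.sum_congr rfl fun i _ => ?_
  rw [Matrix.diag_apply, Matrix.mul_apply]
  refine Finset.sum_congr rfl fun j _ => ?_
  rw [hT]
  simp [Matrix.mul_apply, Matrix.single_apply, ite_and, Matrix.transpose_apply]

theorem trace_end_of_apply_eq_sum {α n : Type*} (M : List α)
    (F : α → Matrix n n ℝ →ₗ[ℝ] Matrix n n ℝ)
    (r : ℝ) {T : Matrix n n ℝ →ₗ[ℝ] Matrix n n ℝ}
    (hT : ∀ X, T X = r • (M.map fun K => F K X).sum) :
    LinearMap.trace ℝ _ T = r * (M.map fun K => LinearMap.trace ℝ _ (F K)).sum := by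
  have h : T = r • (M.map F).sum := by
    ext1 X
    rw [hT, LinearMap.smul_apply]
    congr 1
    clear hT
    induction M with
    | nil => simp
    | cons K M ih => simp [ih]
  rw [h, map_smul, smul_eq_mul]
  congr 1
  clear hT h
  induction M with
  | nil => simp
  | cons K M ih => simp [ih]

theorem sum_map_sublists_eq_nil {α : Type*} (L : List α) (f : List α → ℝ)
    (hf : ∀ K, K.Sublist L → K ≠ [] → f K = 0) : (L.sublists'.map f).sum = f [] := by
  induction L with
  | nil => simp
  | cons a L ih =>
    rw [List.sublists'_cons, List.map_append, List.sum_append, List.map_map,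
      ih fun K hK => hf K (hK.cons a)]
    have : (L.sublists'.map (f ∘ List.cons a)).sum = 0 := by
      refine List.sum_eq_zero fun x hx => ?_
      obtain ⟨K, hK, rfl⟩ := List.mem_map.mp hx
      exact hf _ ((List.mem_sublists'.mp hK).cons_cons a) (by simp)
    rw [this, add_zero]

end MatrixTraces

/-! ### The centralizer of a symmetric Clifford family is the quaternion algebra -/

section Schur

variable {n : Type*} [Fintype n] [DecidableEq n] {m : ℕ} {γ : Fin m → Matrix n n ℝ}

/-- A nonempty monomial anticommutes with some generator: one of its factors if its length is even,
one outside it if the length is odd. The latter exists because `m` is even. Conjugating by that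
generator negates the trace. -/
theorem IsCliffordFamily.trace_monomial (hγ : IsCliffordFamily γ) (hm : Even m)
    {K : List (Fin m)} (hK : K.Nodup) (hne : K ≠ []) : (monomial γ K).trace = 0 := by
  obtain ⟨j, hj⟩ : ∃ j, γ j * monomial γ K = -(monomial γ K * γ j) := by
    rcases Nat.even_or_odd K.length with h | h
    · obtain ⟨j, hj⟩ := List.exists_mem_of_ne_nil K hne
      refine ⟨j, ?_⟩
      rw [hγ.mul_monomial_of_mem hK hj, h.add_one.neg_one_pow, neg_one_smul]
    · have hlt : ∃ j, j ∉ K := by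
        by_contra! hall
        have h1 : K.length = m := by
          rw [← List.toFinset_card_of_nodup hK,
            show K.toFinset = Finset.univ by ext j; simp [hall j]]
          simp
        exact (Nat.not_even_iff_odd.mpr h) (by rw [h1]; exact hm)
      obtain ⟨j, hj⟩ := hlt
      exact ⟨j, by rw [hγ.mul_monomial_of_notMem hj, h.neg_one_pow, neg_one_smul]⟩
  have h1 : (monomial γ K).trace = -(monomial γ K).trace := by
    calc (monomial γ K).trace = (γ j * (γ j * monomial γ K)).trace := by
          rw [← mul_assoc, hγ.sq, one_mul]
      _ = -(γ j * (monomial γ K * γ j)).trace := by rw [hj, mul_neg, Matrix.trace_neg]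
      _ = -(monomial γ K).trace := by
          rw [Matrix.trace_mul_comm, mul_assoc, hγ.sq, mul_one]
  linarith

theorem transpose_monomial (hs : ∀ i, (γ i).transpose = γ i) (K : List (Fin m)) :
    (monomial γ K).transpose = monomial γ K.reverse := by
  induction K with
  | nil => simp
  | cons j K ih =>
    rw [monomial_cons, Matrix.transpose_mul, ih, hs, List.reverse_cons, monomial_append,
      monomial_cons, monomial_nil, mul_one]

/-- Needed so that symmetrizing an averaged matrix stays inside the centralizer. -/
theorem transpose_conjAverage (hs : ∀ i, (γ i).transpose = γ i) (L : List (Fin m))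
    (X : Matrix n n ℝ) : (conjAverage γ L X).transpose = conjAverage γ L X.transpose := by
  induction L with
  | nil => rfl
  | cons j L ih =>
    rw [conjAverage_cons, conjAverage_cons, Matrix.transpose_smul, Matrix.transpose_add,
      Matrix.transpose_mul, Matrix.transpose_mul, ih, hs, mul_assoc]

theorem trace_conjAverage (hγ : IsCliffordFamily γ) (hm : Even m) :
    LinearMap.trace ℝ _ (conjAverage γ (List.finRange m))
      = (1 / 2 : ℝ) ^ m * (Fintype.card n : ℝ) ^ 2 := by
  rw [trace_end_of_apply_eq_sum (List.finRange m).sublists'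
    (fun K => LinearMap.mulLeft ℝ (monomial γ K) ∘ₗ LinearMap.mulRight ℝ (monomial γ K.reverse))
    ((1 / 2 : ℝ) ^ m) (fun X => by
      rw [conjAverage_eq_sum, List.length_finRange]; simp [mul_assoc])]
  congr 1
  have h : ∀ K : List (Fin m), LinearMap.trace ℝ _
      (LinearMap.mulLeft ℝ (monomial γ K) ∘ₗ LinearMap.mulRight ℝ (monomial γ K.reverse))
        = (monomial γ K).trace * (monomial γ K.reverse).trace := fun K =>
    trace_end_of_apply_eq_mul (fun X => by simp [mul_assoc])
  rw [sum_map_sublists_eq_nil]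
  · rw [h]
    simp [pow_two]
  · intro K hK hne
    rw [h, hγ.trace_monomial hm (hK.nodup (List.nodup_finRange m)) hne, zero_mul]

/-- In contrast with `trace_conjAverage`, where only the empty monomial survives, here every
monomial contributes the trace of its square, a sign times the matrix size. -/
theorem trace_conjAverage_transpose (hγ : IsCliffordFamily γ) (hs : ∀ i, (γ i).transpose = γ i)
    {t : ℕ} (ht : m = 8 * t + 6) :
    LinearMap.trace ℝ _ (conjAverage γ (List.finRange m) ∘ₗ
        (Matrix.transposeLinearEquiv n n ℝ ℝ).toLinearMap)
      = (1 / 2 : ℝ) ^ m * (-8 * 16 ^ t * (Fintype.card n : ℝ)) := by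
  rw [trace_end_of_apply_eq_sum (List.finRange m).sublists'
    (fun K => (LinearMap.mulLeft ℝ (monomial γ K) ∘ₗ
      LinearMap.mulRight ℝ (monomial γ K.reverse)) ∘ₗ
        (Matrix.transposeLinearEquiv n n ℝ ℝ).toLinearMap)
    ((1 / 2 : ℝ) ^ m) (fun X => by
      rw [LinearMap.comp_apply, conjAverage_eq_sum, List.length_finRange]; simp [mul_assoc])]
  congr 1
  have h : ∀ K ∈ (List.finRange m).sublists', LinearMap.trace ℝ _
      ((LinearMap.mulLeft ℝ (monomial γ K) ∘ₗ LinearMap.mulRight ℝ (monomial γ K.reverse)) ∘ₗ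
        (Matrix.transposeLinearEquiv n n ℝ ℝ).toLinearMap)
        = (-1) ^ (K.length.choose 2) * (Fintype.card n : ℝ) := fun K hK => by
    rw [trace_end_of_apply_eq_mul_transpose (A := monomial γ K) (B := monomial γ K.reverse)
      (fun X => by simp [mul_assoc]), transpose_monomial hs, List.reverse_reverse,
      hγ.monomial_mul_self ((List.mem_sublists'.mp hK).nodup (List.nodup_finRange m)),
      Matrix.trace_smul, Matrix.trace_one, smul_eq_mul]
  rw [List.map_congr_left h, List.sum_map_mul_right,
    sum_sublists_of_length (f := fun k => (-1) ^ (k.choose 2)) neg_one_pow_choose_two_add_two t _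
      (by rw [List.length_finRange, ht])]
  simp

/-- If only the scalars are symmetric and commute with a Clifford family of symmetric matrices, of
cardinality congruent to `6` modulo `8`, then the centralizer of the family has dimension `4`. -/
theorem finrank_centralizer_eq_four [Nonempty n] (hγ : IsCliffordFamily γ)
    (hs : ∀ i, (γ i).transpose = γ i) {t : ℕ} (ht : m = 8 * t + 6)
    (hirr : ∀ X : Matrix n n ℝ, X.transpose = X → (∀ i, γ i * X = X * γ i) → ∃ r : ℝ, X = r • 1) :
    Module.finrank ℝ (Subalgebra.centralizer ℝ (Set.range γ)) = 4 := by
  set P := conjAverage γ (List.finRange m) with hP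
  set C := Subalgebra.toSubmodule (Subalgebra.centralizer ℝ (Set.range γ)) with hC
  set T := (Matrix.transposeLinearEquiv n n ℝ ℝ).toLinearMap with hT
  have hmem : ∀ X, X ∈ C ↔ ∀ i, γ i * X = X * γ i := fun X => by
    simp [hC, Subalgebra.mem_centralizer_iff]
  have hPcomm : ∀ X i, γ i * P X = P X * γ i := fun X i =>
    hγ.commute_conjAverage (List.mem_finRange i) X
  have hproj : LinearMap.IsProj C P :=
    ⟨fun X => (hmem _).mpr (hPcomm X),
      fun X hX => hγ.conjAverage_eq_self fun i _ => (hmem X).mp hX i⟩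
  have hm : Even m := ⟨4 * t + 3, by omega⟩
  have hd : (Module.finrank ℝ C : ℝ) = (1 / 2 : ℝ) ^ m * (Fintype.card n : ℝ) ^ 2 := by
    rw [← hproj.trace, trace_conjAverage hγ hm]
  -- The symmetric part of the averaged matrix is symmetric and central for the family, hence
  -- scalar.
  have hproj' : LinearMap.IsProj (Submodule.span ℝ {(1 : Matrix n n ℝ)})
      ((1 / 2 : ℝ) • (P + P ∘ₗ T)) := by
    refine ⟨fun X => ?_, fun X hX => ?_⟩
    · obtain ⟨r, hr⟩ := hirr (((1 / 2 : ℝ) • (P + P ∘ₗ T)) X) (by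
        simp [hT, hP, transpose_conjAverage hs, add_comm]) (fun i => by
        simp [mul_add, add_mul, hPcomm])
      rw [hr]
      exact Submodule.smul_mem _ _ (Submodule.mem_span_singleton_self _)
    · obtain ⟨r, rfl⟩ := Submodule.mem_span_singleton.mp hX
      have h1 : P 1 = 1 := hγ.conjAverage_eq_self fun i _ => by simp
      simp only [LinearMap.smul_apply, LinearMap.add_apply, LinearMap.comp_apply, map_smul, h1,
        show T 1 = 1 by simp [hT]]
      module
  have htr : (1 : ℝ) = 1 / 2 * ((1 / 2 : ℝ) ^ m * (Fintype.card n : ℝ) ^ 2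
      + (1 / 2 : ℝ) ^ m * (-8 * 16 ^ t * (Fintype.card n : ℝ))) := by
    rw [← trace_conjAverage hγ hm, ← trace_conjAverage_transpose hγ hs ht, ← map_add,
      ← smul_eq_mul, ← map_smul, hproj'.trace, finrank_span_singleton one_ne_zero, Nat.cast_one]
  have hpow : (1 / 2 : ℝ) ^ m = 1 / (8 * 16 ^ t) ^ 2 := by
    have h : ((1 / 2 : ℝ) ^ 8) ^ t * (16 ^ t) ^ 2 = 1 := by
      rw [pow_right_comm 16 t 2, ← mul_pow]
      norm_num
    rw [ht, pow_add, pow_mul, eq_div_iff (by positivity)]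
    linear_combination h
  set u : ℝ := Fintype.card n / (8 * 16 ^ t) with hu
  have hu0 : 0 ≤ u := by positivity
  have h16 : (8 * 16 ^ t : ℝ) ≠ 0 := by positivity
  have hN : (Fintype.card n : ℝ) = u * (8 * 16 ^ t) := by rw [hu]; field_simp
  rw [hpow, hN] at htr hd
  have hu2 : u ^ 2 - u = 2 := by
    have : (1 : ℝ) = 1 / 2 * (u ^ 2 - u) := by
      refine htr.trans ?_
      field_simp
      ring
    linarith
  -- The other root `-1` is excluded because `u` is a ratio of nonnegative numbers; the dimension is
  -- then `u ^ 2`.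
  have hu3 : u = 2 := by
    have : (u - 2) * (u + 1) = 0 := by linear_combination hu2
    rcases mul_eq_zero.mp this with h | h <;> linarith
  have h4 : (Module.finrank ℝ C : ℝ) = 4 := by
    rw [hd, hu3]; field_simp; norm_num
  exact_mod_cast h4

/-- A skew matrix whose square is scalar squares to a negative scalar. -/
theorem neg_of_mul_self_eq_smul_one {X : Matrix n n ℝ} (hX : X.transpose = -X) (h0 : X ≠ 0) {a : ℝ}
    (ha : X * X = a • 1) : a < 0 := by
  -- The trace of `X Xᵀ` is computed twice: from the scalar square, and as the sum of the squared
  -- entries.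
  have h1 : (X * X.transpose).trace = -(a * Fintype.card n) := by
    rw [hX, mul_neg, ha, Matrix.trace_neg, Matrix.trace_smul, Matrix.trace_one, smul_eq_mul]
  have h2 : (X * X.transpose).trace = ∑ i, ∑ j, X i j ^ 2 := by
    simp [Matrix.trace, Matrix.mul_apply, pow_two]
  have h3 : 0 < ∑ i, ∑ j, X i j ^ 2 := by
    refine lt_of_le_of_ne (by positivity) fun h => h0 ?_
    ext i j
    have hi := (Finset.sum_eq_zero_iff_of_nonneg (fun i _ => by positivity)).mp h.symm i
      (Finset.mem_univ i)
    have hj := (Finset.sum_eq_zero_iff_of_nonneg (fun i _ => by positivity)).mp hi j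
      (Finset.mem_univ j)
    simpa using hj
  have h4 : a * Fintype.card n < 0 := by linarith
  by_contra! h
  have : 0 ≤ a * (Fintype.card n : ℝ) := by positivity
  linarith

/-- A four-dimensional algebra of matrices that is closed under transposition and in which only
the scalars are symmetric is isomorphic to the quaternions. -/
theorem nonempty_quaternion_equiv [Nonempty n] (C : Subalgebra ℝ (Matrix n n ℝ))
    (hT : ∀ X ∈ C, X.transpose ∈ C) (hsymm : ∀ X ∈ C, X.transpose = X → ∃ r : ℝ, X = r • 1)
    (hd : Module.finrank ℝ C = 4) : Nonempty (ℍ[ℝ] ≃ₐ[ℝ] C) := by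
  have hsmall : ∀ s : Finset (Matrix n n ℝ), s.card < 4 →
      ∃ Y ∈ C, Y ∉ Submodule.span ℝ (s : Set (Matrix n n ℝ)) := by
    intro s hs
    by_contra! h
    have h1 : Subalgebra.toSubmodule C ≤ Submodule.span ℝ (s : Set (Matrix n n ℝ)) := h
    have h2 := Submodule.finrank_mono h1
    have h3 := finrank_span_finset_le_card (R := ℝ) s
    rw [Set.finrank] at h3
    have h4 : Module.finrank ℝ (Subalgebra.toSubmodule C) = 4 := hd
    omega
  have hunit : ∀ X ∈ C, X.transpose = -X → X ≠ 0 →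
      ∃ c : ℝ, (c • X) * (c • X) = -1 := by
    intro X hX hXT h0
    -- The square of a skew element is symmetric, hence scalar, and negative; rescaling yields an
    -- imaginary unit.
    obtain ⟨a, ha⟩ := hsymm (X * X) (C.mul_mem hX hX) (by rw [Matrix.transpose_mul, hXT]; simp)
    have hneg := neg_of_mul_self_eq_smul_one hXT h0 ha
    refine ⟨(√(-a))⁻¹, ?_⟩
    rw [smul_mul_smul_comm, ha, smul_smul, ← mul_inv, Real.mul_self_sqrt (by linarith)]
    rw [show (-a)⁻¹ * a = -1 by field_simp [hneg.ne], neg_one_smul]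
  obtain ⟨Y, hY, hYn⟩ := hsmall {1} (by simp)
  have hskew : ∀ Z : Matrix n n ℝ, (Z - Z.transpose).transpose = -(Z - Z.transpose) := by
    intro Z; simp
  obtain ⟨c, hc⟩ := hunit (Y - Y.transpose) (C.sub_mem hY (hT Y hY)) (hskew Y) (fun h => by
    obtain ⟨r, hr⟩ := hsymm Y hY (sub_eq_zero.mp h).symm
    exact hYn (by
      rw [hr]; exact Submodule.smul_mem _ _ (Submodule.subset_span (by simp))))
  set I := c • (Y - Y.transpose) with hI
  have hIC : I ∈ C := C.smul_mem (C.sub_mem hY (hT Y hY)) c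
  have hIT : I.transpose = -I := by rw [hI, Matrix.transpose_smul, hskew, smul_neg]
  clear_value I
  obtain ⟨Z, hZ, hZn⟩ := hsmall {1, I} (lt_of_le_of_lt (Finset.card_le_two) (by norm_num))
  set Z' := Z - Z.transpose with hZ'
  have hZ'C : Z' ∈ C := C.sub_mem hZ (hT Z hZ)
  have hZ'T : Z'.transpose = -Z' := hskew Z
  clear_value Z'
  obtain ⟨r, hr⟩ := hsymm (Z + Z.transpose) (C.add_mem hZ (hT Z hZ)) (by simp [add_comm])
  obtain ⟨a, ha⟩ := hsymm (I * Z' + Z' * I) (C.add_mem (C.mul_mem hIC hZ'C) (C.mul_mem hZ'C hIC))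
    (by rw [Matrix.transpose_add, Matrix.transpose_mul, Matrix.transpose_mul, hIT, hZ'T]
        simp [add_comm])
  -- A Gram–Schmidt step: as `I² = -1`, the correction `a / 2` cancels the anticommutator `a` of `I`
  -- and `Z'`.
  set U := Z' + (a / 2) • I with hU
  have hUC : U ∈ C := C.add_mem hZ'C (C.smul_mem hIC _)
  have hUI : I * U = -(U * I) := by
    rw [eq_neg_iff_add_eq_zero, hU, mul_add, add_mul, mul_smul_comm, smul_mul_assoc, hc,
      add_add_add_comm, ha]
    module
  have hUT : U.transpose = -U := by
    rw [hU, Matrix.transpose_add, hZ'T, Matrix.transpose_smul, hIT]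
    simp [add_comm]
  obtain ⟨d, hdd⟩ := hunit U hUC hUT (fun h => hZn (by
    have h1 : Z = (r / 2) • (1 : Matrix n n ℝ) + (-(a / 4)) • I := by
      have h2 : Z = (1 / 2 : ℝ) • ((Z + Z.transpose) + Z') := by
        rw [hZ', add_add_sub_cancel, ← two_smul ℝ, smul_smul]; norm_num
      have h3 : Z' = -((a / 2) • I) := eq_neg_of_add_eq_zero_left h
      rw [h2, hr, h3]
      module
    rw [h1]
    exact Submodule.add_mem _ (Submodule.smul_mem _ _ (Submodule.subset_span (by simp)))
      (Submodule.smul_mem _ _ (Submodule.subset_span (by simp)))))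
  set J := d • U with hJ
  have hJC : J ∈ C := C.smul_mem hUC d
  have hJI : J * I = -(I * J) := by
    rw [hJ, smul_mul_assoc, mul_smul_comm, hUI, smul_neg, neg_neg]
  let q : QuaternionAlgebra.Basis C (-1 : ℝ) 0 (-1) :=
    { i := ⟨I, hIC⟩
      j := ⟨J, hJC⟩
      k := ⟨I * J, C.mul_mem hIC hJC⟩
      i_mul_i := by ext1; simp [hc]
      j_mul_j := by ext1; simp [hdd]
      i_mul_j := rfl
      j_mul_i := by ext1; simp [hJI] }
  let φ : ℍ[ℝ] →ₐ[ℝ] C := q.liftHom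
  -- The quaternions form a division ring, so a homomorphism to a nontrivial ring is injective; the
  -- dimension count gives surjectivity.
  have hinj : Function.Injective φ := φ.toRingHom.injective
  have hfr : Module.finrank ℝ ℍ[ℝ] = Module.finrank ℝ C := by
    rw [Quaternion.finrank_eq_four, hd]
  have : FiniteDimensional ℝ C := FiniteDimensional.of_finrank_pos (by omega)
  have hsurj : Function.Surjective φ :=
    (LinearMap.injective_iff_surjective_of_finrank_eq_finrank (f := φ.toLinearMap) hfr).mp hinj
  exact ⟨AlgEquiv.ofBijective φ ⟨hinj, hsurj⟩⟩

end Schur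


/-! ### Finite-dimensional stable subspaces and invariant scalar products -/

section InvariantForms

variable {V ι : Type*} [AddCommGroup V] [Module ℝ V]

theorem IsCliffordFamily.apply_apply {γ : ι → Module.End ℝ V} (hγ : IsCliffordFamily γ) (i : ι)
    (x : V) : γ i (γ i x) = x := by
  rw [← Module.End.mul_apply, hγ.sq, Module.End.one_apply]

theorem IsCliffordFamily.apply_comm {γ : ι → Module.End ℝ V} (hγ : IsCliffordFamily γ) {i j : ι}
    (h : i ≠ j) (x : V) : γ i (γ j x) = -γ j (γ i x) := by
  rw [← Module.End.mul_apply, hγ.anticomm i j h]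
  rfl

/-- Every vector lies in a finite-dimensional subspace that is stable under finitely many members
of a Clifford family. -/
theorem IsCliffordFamily.exists_finite_stable {γ : ι → Module.End ℝ V} (hγ : IsCliffordFamily γ)
    (L : List ι) (v : V) : ∃ W : Submodule ℝ V, v ∈ W ∧ FiniteDimensional ℝ W ∧
      ∀ i ∈ L, ∀ w ∈ W, γ i w ∈ W := by
  induction L with
  | nil => exact ⟨Submodule.span ℝ {v}, Submodule.mem_span_singleton_self v, inferInstance, by simp⟩
  | cons j L ih =>
    obtain ⟨W, hv, hW, hs⟩ := ih
    -- The involution `γ j` exchanges the two summands, and the earlier members preserve each of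
    -- them because they anticommute with `γ j`.
    refine ⟨W ⊔ W.map (γ j), Submodule.mem_sup_left hv, inferInstance, fun i hi w hw => ?_⟩
    obtain ⟨x, hx, y, ⟨z, hz, rfl⟩, rfl⟩ := Submodule.mem_sup.mp hw
    rw [map_add]
    by_cases hij : i = j
    · subst hij
      rw [hγ.apply_apply]
      exact Submodule.add_mem _ (Submodule.mem_sup_right (Submodule.mem_map_of_mem hx))
        (Submodule.mem_sup_left hz)
    · have hiL : i ∈ L := by simpa [hij] using hi
      rw [hγ.apply_comm hij]
      exact Submodule.add_mem _ (Submodule.mem_sup_left (hs i hiL x hx))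
        (Submodule.neg_mem _ (Submodule.mem_sup_right (Submodule.mem_map_of_mem (hs i hiL z hz))))

/-- Adding to a form its pullback by the involution `γ j` makes it invariant under `γ j`. Earlier
invariances survive, since the signs from anticommutation occur in both arguments. -/
theorem IsCliffordFamily.exists_invariant_form [FiniteDimensional ℝ V] {γ : ι → Module.End ℝ V}
    (hγ : IsCliffordFamily γ) (L : List ι) : ∃ β : LinearMap.BilinForm ℝ V,
      (∀ x y, β x y = β y x) ∧ (∀ x, x ≠ 0 → 0 < β x x) ∧
      ∀ i ∈ L, ∀ x y, β (γ i x) (γ i y) = β x y := by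
  induction L with
  | nil =>
    let φ : V ≃ₗ[ℝ] EuclideanSpace ℝ (Fin (Module.finrank ℝ V)) :=
      LinearEquiv.ofFinrankEq _ _ (by simp)
    refine ⟨(innerₗ _).compl₁₂ φ.toLinearMap φ.toLinearMap, fun x y => ?_, fun x hx => ?_, by simp⟩
    · simp [real_inner_comm]
    · have : 0 < ‖φ x‖ := norm_pos_iff.mpr (by simpa using hx)
      simpa using pow_pos this 2
  | cons j L ih =>
    obtain ⟨β, hsymm, hpos, hinv⟩ := ih
    refine ⟨β + β.compl₁₂ (γ j) (γ j), fun x y => ?_, fun x hx => ?_, fun i hi x y => ?_⟩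
    · simp [hsymm x, hsymm (γ j x)]
    · have hx' : γ j x ≠ 0 := fun h => hx (by rw [← hγ.apply_apply j x, h, map_zero])
      simpa using add_pos (hpos x hx) (hpos _ hx')
    · simp only [LinearMap.add_apply, LinearMap.compl₁₂_apply]
      by_cases hij : i = j
      · subst hij
        rw [hγ.apply_apply, hγ.apply_apply, add_comm]
      · have hiL : i ∈ L := by simpa [hij] using hi
        rw [hγ.apply_comm (Ne.symm hij), hγ.apply_comm (Ne.symm hij) y, hinv i hiL]
        simp [hinv i hiL]

theorem exists_orthonormal_basis_of_form [FiniteDimensional ℝ V] (β : LinearMap.BilinForm ℝ V)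
    (hsymm : ∀ x y, β x y = β y x) (hpos : ∀ x, x ≠ 0 → 0 < β x x) :
    ∃ v : Module.Basis (Fin (Module.finrank ℝ V)) ℝ V, ∀ i x, v.repr x i = β (v i) x := by
  let core : InnerProductSpace.Core ℝ V :=
    { inner := fun x y => β x y
      conj_inner_symm := fun x y => hsymm y x
      re_inner_nonneg := fun x => by
        by_cases hx : x = 0
        · simp [hx]
        · exact (hpos x hx).le
      add_left := fun x y z => by simp
      smul_left := fun x y r => by simp
      definite := fun x h => by
        by_contra hx
        exact (hpos x hx).ne' h }
  let _ : NormedAddCommGroup V := core.toNormedAddCommGroup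
  let _ : InnerProductSpace ℝ V := InnerProductSpace.ofCore core.toCore
  refine ⟨(stdOrthonormalBasis ℝ V).toBasis, fun i x => ?_⟩
  rw [OrthonormalBasis.coe_toBasis_repr_apply, OrthonormalBasis.repr_apply_apply,
    OrthonormalBasis.coe_toBasis]
  rfl

end InvariantForms

/-! ### The even Schur algebra of a simple Clifford module -/

section SchurAlgebra

variable {E : Type*} [NormedAddCommGroup E] [InnerProductSpace ℝ E]
variable {S₀ : Type*} [AddCommGroup S₀] [Module ℝ S₀] [Module (ClE E) S₀]
  [IsScalarTower ℝ (ClE E) S₀]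

theorem euclForm_apply (e : E) : euclForm E e = inner ℝ e e := by
  simp [euclForm]

theorem clMul_mul_add_swap (e f : E) :
    clMul S₀ e * clMul S₀ f + clMul S₀ f * clMul S₀ e = (2 * inner ℝ e f : ℝ) • 1 := by
  have h : ∀ g : E, clMul S₀ g * clMul S₀ g = (inner ℝ g g : ℝ) • 1 := fun g => by
    ext s
    rw [Module.End.mul_apply, clMul_clMul, euclForm_apply]
    rfl
  have h1 := h (e + f)
  rw [map_add, mul_add, add_mul, add_mul, h e, h f, inner_add_left, inner_add_right,
    inner_add_right, real_inner_comm e f] at h1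
  have h2 : clMul S₀ e * clMul S₀ f + clMul S₀ f * clMul S₀ e
      = ((inner ℝ e e : ℝ) • 1 + clMul S₀ f * clMul S₀ e +
        (clMul S₀ e * clMul S₀ f + (inner ℝ f f : ℝ) • 1)) - (inner ℝ e e : ℝ) • 1
        - (inner ℝ f f : ℝ) • 1 := by abel
  rw [h2, h1]
  module

theorem clMul_isCliffordFamily {ι : Type*} {e : ι → E} (he : Orthonormal ℝ e) :
    IsCliffordFamily fun i => clMul S₀ (e i) where
  sq i := by
    have h := clMul_mul_add_swap (S₀ := S₀) (e i) (e i)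
    rw [real_inner_self_eq_norm_sq, he.1 i, ← two_smul ℝ] at h
    have h2 := congrArg (fun x => (1 / 2 : ℝ) • x) h
    simpa [smul_smul] using h2
  anticomm i j hij := by
    have h := clMul_mul_add_swap (S₀ := S₀) (e i) (e j)
    rw [he.2 hij, mul_zero, zero_smul] at h
    exact eq_neg_of_add_eq_zero_left h

variable {ι : Type*} [Fintype ι] (ε : OrthonormalBasis ι ℝ E)

theorem clMul_eq_sum (e : E) : clMul S₀ e = ∑ i, (inner ℝ (ε i) e : ℝ) • clMul S₀ (ε i) := by
  conv_lhs => rw [← ε.sum_repr' e]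
  simp

theorem mem_evenSchur_iff {x : Module.End ℝ S₀} :
    x ∈ evenSchur E S₀ ↔ ∀ e : E, clMul S₀ e * x = x * clMul S₀ e := by
  simp [evenSchur, Subalgebra.mem_centralizer_iff]

theorem evenSchur_eq_centralizer :
    evenSchur E S₀ = Subalgebra.centralizer ℝ (Set.range fun i => clMul S₀ (ε i)) := by
  ext x
  rw [mem_evenSchur_iff]
  simp only [Subalgebra.mem_centralizer_iff, Set.forall_mem_range]
  refine ⟨fun h i => h _, fun h e => ?_⟩
  rw [clMul_eq_sum ε e, Finset.sum_mul, Finset.mul_sum]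
  refine Finset.sum_congr rfl fun i _ => ?_
  rw [smul_mul_assoc, mul_smul_comm, h]

/-- A nonzero subspace of a simple Clifford module that is stable under Clifford multiplication is
everything. -/
theorem eq_top_of_stable [IsSimpleModule (ClE E) S₀] (W : Submodule ℝ S₀) (hW : W ≠ ⊥)
    (h : ∀ i, ∀ w ∈ W, clMul S₀ (ε i) w ∈ W) : W = ⊤ := by
  have h' : ∀ e : E, ∀ w ∈ W, clMul S₀ e w ∈ W := fun e w hw => by
    rw [clMul_eq_sum ε e, LinearMap.sum_apply]
    exact Submodule.sum_mem _ fun i _ => Submodule.smul_mem _ _ (h i w hw)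
  have hsmul : ∀ a : ClE E, ∀ w ∈ W, a • w ∈ W := by
    intro a
    induction a using CliffordAlgebra.induction with
    | algebraMap r => intro w hw; rw [algebraMap_smul]; exact W.smul_mem r hw
    | ι x => exact h' x
    | mul a b ha hb => intro w hw; rw [mul_smul]; exact ha _ (hb w hw)
    | add a b ha hb => intro w hw; rw [add_smul]; exact W.add_mem (ha w hw) (hb w hw)
  let W' : Submodule (ClE E) S₀ :=
    { carrier := W
      add_mem' := W.add_mem
      zero_mem' := W.zero_mem
      smul_mem' := fun a w hw => hsmul a w hw }
  rcases eq_bot_or_eq_top W' with h0 | h1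
  · refine absurd (le_bot_iff.mp fun w hw => ?_) hW
    have : w ∈ W' := hw
    rw [h0] at this
    exact this
  · refine top_le_iff.mp fun w _ => ?_
    have : w ∈ W' := h1 ▸ Submodule.mem_top
    exact this

/-- A finite-dimensional stable subspace through a nonzero vector exhausts the simple module. -/
theorem finiteDimensional_of_isSimpleModule {ι : Type*} [Fintype ι]
    (ε : OrthonormalBasis ι ℝ E) [IsSimpleModule (ClE E) S₀] :
    FiniteDimensional ℝ S₀ := by
  have : Nontrivial S₀ := IsSimpleModule.nontrivial (ClE E) S₀
  obtain ⟨v, hv⟩ := exists_ne (0 : S₀)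
  obtain ⟨W, hvW, hW, hs⟩ := (clMul_isCliffordFamily (S₀ := S₀) ε.orthonormal).exists_finite_stable
    Finset.univ.toList v
  have htop : W = ⊤ := eq_top_of_stable ε W (fun h => hv (by simpa [h] using hvW))
    fun i w hw => hs i (by simp) w hw
  subst htop
  exact Module.Finite.equiv Submodule.topEquiv

/-- In dimension congruent to `6` modulo `8` the even Schur algebra is the quaternion algebra. -/
theorem nonempty_quaternion_equiv_evenSchur {m : ℕ} (hm : m ≡ 6 [MOD 8])
    (ε : OrthonormalBasis (Fin m) ℝ E) [IsSimpleModule (ClE E) S₀] :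
    Nonempty (ℍ[ℝ] ≃ₐ[ℝ] evenSchur E S₀) := by
  have : Nontrivial S₀ := IsSimpleModule.nontrivial (ClE E) S₀
  have : FiniteDimensional ℝ S₀ := finiteDimensional_of_isSimpleModule ε
  set γ : Fin m → Module.End ℝ S₀ := fun i => clMul S₀ (ε i) with hγdef
  have hγ : IsCliffordFamily γ := clMul_isCliffordFamily ε.orthonormal
  obtain ⟨β, hsymm, hpos, hinv⟩ := hγ.exists_invariant_form (List.finRange m)
  obtain ⟨v, hv⟩ := exists_orthonormal_basis_of_form β hsymm hpos
  have : Nonempty (Fin (Module.finrank ℝ S₀)) := ⟨⟨0, Module.finrank_pos⟩⟩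
  let φ := LinearMap.toMatrixAlgEquiv v
  have hφ : ∀ f i j, φ f i j = β (v i) (f (v j)) := fun f i j => by
    rw [LinearMap.toMatrixAlgEquiv_apply, hv]
  have hΓ : IsCliffordFamily fun i => φ (γ i) :=
    ⟨fun i => by rw [← map_mul, hγ.sq, map_one],
      fun i j hij => by rw [← map_mul, hγ.anticomm i j hij, map_neg, map_mul]⟩
  -- An isometry that is an involution is self-adjoint, so in a `β`-orthonormal basis the family
  -- consists of symmetric matrices.
  have hadj : ∀ i x y, β (γ i x) y = β x (γ i y) := fun i x y => by
    rw [← hinv i (List.mem_finRange i) x, hγ.apply_apply]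
  have hΓs : ∀ i, (φ (γ i)).transpose = φ (γ i) := fun i => by
    ext j k
    rw [Matrix.transpose_apply, hφ, hφ, ← hadj, hsymm]
  have hirr : ∀ X, X.transpose = X → (∀ i, φ (γ i) * X = X * φ (γ i)) →
      ∃ r : ℝ, X = r • 1 := by
    intro X hX hcomm
    have hH : X.IsHermitian := by
      rw [Matrix.IsHermitian, Matrix.conjTranspose_eq_transpose_of_trivial, hX]
    set i₀ : Fin (Module.finrank ℝ S₀) := ⟨0, Module.finrank_pos⟩
    set r := hH.eigenvalues i₀
    set F := φ.symm X with hF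
    have hXF : X = φ F := by rw [hF, AlgEquiv.apply_symm_apply]
    have hFcomm : ∀ i, γ i * F = F * γ i := fun i => φ.injective (by
      rw [map_mul, map_mul, ← hXF, hcomm])
    -- Schur's lemma over the reals: a symmetric matrix has a real eigenvalue, and this eigenspace
    -- is a nonzero Clifford-stable subspace.
    have htop : LinearMap.ker (F - r • 1) = ⊤ := by
      refine eq_top_of_stable ε _ ?_ fun i w hw => ?_
      · set w : Fin (Module.finrank ℝ S₀) → ℝ := (hH.eigenvectorBasis i₀).ofLp with hw
        have hw0 : w ≠ 0 := fun h => (hH.eigenvectorBasis.orthonormal.ne_zero i₀) (by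
          ext k; exact congrFun h k)
        have hXw : X.mulVec w = r • w := hH.mulVec_eigenvectorBasis i₀
        refine (Submodule.ne_bot_iff _).mpr ⟨v.equivFun.symm w, ?_,
          fun h => hw0 ((LinearEquiv.map_eq_zero_iff _).mp h)⟩
        rw [LinearMap.mem_ker, LinearMap.sub_apply, sub_eq_zero]
        apply v.equivFun.injective
        have h1 := LinearMap.toMatrix_mulVec_repr v v F (v.equivFun.symm w)
        have h2 : (v.repr (v.equivFun.symm w) : _ → ℝ) = w := v.equivFun.apply_symm_apply w
        rw [h2] at h1
        have h3 : LinearMap.toMatrix v v F = X := hXF.symm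
        rw [h3, hXw] at h1
        change (v.repr (F (v.equivFun.symm w)) : _ → ℝ) = _
        rw [← h1, LinearMap.smul_apply, Module.End.one_apply, map_smul,
          LinearEquiv.apply_symm_apply]
      · rw [LinearMap.mem_ker, LinearMap.sub_apply, sub_eq_zero] at hw ⊢
        change F (γ i w) = (r • (1 : Module.End ℝ S₀)) (γ i w)
        rw [← Module.End.mul_apply, ← hFcomm, Module.End.mul_apply, hw]
        simp
    have hF' : F = r • 1 := sub_eq_zero.mp (LinearMap.ker_eq_top.mp htop)
    exact ⟨r, by rw [hXF, hF', map_smul, map_one]⟩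
  have hm' : m = 8 * (m / 8) + 6 := by
    have : m % 8 = 6 := hm
    omega
  have h4 := finrank_centralizer_eq_four hΓ hΓs hm' hirr
  have hmem : ∀ X, X ∈ Subalgebra.centralizer ℝ (Set.range fun i => φ (γ i)) ↔
      ∀ i, φ (γ i) * X = X * φ (γ i) := fun X => by
    simp [Subalgebra.mem_centralizer_iff]
  obtain ⟨Ψ⟩ := nonempty_quaternion_equiv _ (fun X hX => (hmem _).mpr fun i => by
    have := congrArg Matrix.transpose ((hmem X).mp hX i)
    rw [Matrix.transpose_mul, Matrix.transpose_mul, hΓs] at this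
    exact this.symm) (fun X hX hXT => hirr X hXT ((hmem X).mp hX)) h4
  have hmap : (evenSchur E S₀).map φ.toAlgHom
      = Subalgebra.centralizer ℝ (Set.range fun i => φ (γ i)) := by
    ext X
    rw [hmem, evenSchur_eq_centralizer ε]
    constructor
    · rintro ⟨x, hx, rfl⟩ i
      have : γ i * x = x * γ i := hx _ ⟨i, rfl⟩
      change φ (γ i) * φ x = φ x * φ (γ i)
      rw [← map_mul, this, map_mul]
    · intro hX
      refine ⟨φ.symm X, ?_, φ.apply_symm_apply X⟩
      rintro _ ⟨i, rfl⟩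
      apply φ.injective
      change φ (γ i * φ.symm X) = φ (φ.symm X * γ i)
      rw [map_mul, map_mul, φ.apply_symm_apply, hX i]
  exact ⟨(Ψ.trans (Subalgebra.equivOfEq _ _ hmap.symm)).trans (φ.subalgebraMap _).symm⟩

end SchurAlgebra


/-! ### Algebra of vectors, commuting quaternions and the volume element -/

section QuaternionicClifford

variable {E : Type*} [NormedAddCommGroup E] [InnerProductSpace ℝ E]
variable {R : Type*} [Ring R] [Algebra ℝ R]

/-- A Clifford map `c : E → R`, commuting quaternions `Q : ℍ → R` and a complex structure `W` that
commutes with the quaternions and anticommutes with the vectors, such that only the quaternions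
commute with all vectors. -/
structure IsQuaternionicClifford (Q : ℍ[ℝ] →ₐ[ℝ] R) (c : E →ₗ[ℝ] R) (W : R) : Prop where
  mul_add_swap : ∀ e f, c e * c f + c f * c e = (2 * inner ℝ e f : ℝ) • 1
  vec_mul : ∀ e h, c e * Q h = Q h * c e
  vol_mul : ∀ h, W * Q h = Q h * W
  vol_vec : ∀ e, W * c e = -(c e * W)
  vol_sq : W * W = -1
  injective : Function.Injective Q
  schur : ∀ x, (∀ e, c e * x = x * c e) → ∃ h, x = Q h

/-- The element `a + b W` of the algebra generated by the quaternions and `W`. -/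
def cx (Q : ℍ[ℝ] →ₐ[ℝ] R) (W : R) (a b : ℍ[ℝ]) : R := Q a + Q b * W

theorem cx_sub (Q : ℍ[ℝ] →ₐ[ℝ] R) (W : R) (a b a' b' : ℍ[ℝ]) :
    cx Q W a b - cx Q W a' b' = cx Q W (a - a') (b - b') := by
  simp only [cx, map_sub]; noncomm_ring

@[simp] theorem cx_zero (Q : ℍ[ℝ] →ₐ[ℝ] R) (W : R) : cx Q W 0 0 = 0 := by simp [cx]

namespace IsQuaternionicClifford

variable {Q : ℍ[ℝ] →ₐ[ℝ] R} {c : E →ₗ[ℝ] R} {W : R}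

theorem cx_mul (H : IsQuaternionicClifford Q c W) (a b a' b' : ℍ[ℝ]) :
    cx Q W a b * cx Q W a' b' = cx Q W (a * a' - b * b') (a * b' + b * a') := by
  have h1 : Q b * W * Q a' = Q b * Q a' * W := by rw [mul_assoc, H.vol_mul, mul_assoc]
  have h2 : Q b * W * (Q b' * W) = -(Q b * Q b') := by
    rw [mul_assoc, ← mul_assoc W, H.vol_mul, mul_assoc (Q b'), H.vol_sq]; noncomm_ring
  rw [cx, cx, mul_add, add_mul, add_mul, h1, h2]
  simp only [cx, map_sub, map_add, map_mul]
  noncomm_ring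

/-- The element `W` anticommutes with vectors, so one vector acts as conjugation on `a + b W` and a
product of two vectors commutes with it. -/
theorem vec_mul_cx (H : IsQuaternionicClifford Q c W) (e : E) (a b : ℍ[ℝ]) :
    c e * cx Q W a b = cx Q W a (-b) * c e := by
  have h : W * c e = -(c e * W) := H.vol_vec e
  rw [cx, cx, mul_add, add_mul, H.vec_mul, ← mul_assoc, H.vec_mul, map_neg, neg_mul, neg_mul,
    mul_assoc (Q b) W, h]
  noncomm_ring

theorem sq_of_norm (H : IsQuaternionicClifford Q c W) {e : E} (he : ‖e‖ = 1) :
    c e * c e = 1 := by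
  have h := H.mul_add_swap e e
  rw [real_inner_self_eq_norm_sq, he, ← two_smul ℝ] at h
  have h2 := congrArg (fun x => (1 / 2 : ℝ) • x) h
  simpa [smul_smul] using h2

theorem anticomm_of_inner (H : IsQuaternionicClifford Q c W) {e f : E} (hef : inner ℝ e f = 0) :
    c e * c f = -(c f * c e) := by
  have h := H.mul_add_swap e f
  rw [hef, mul_zero, zero_smul] at h
  exact eq_neg_of_add_eq_zero_left h

/-- Conjugating by a unit vector shows that `a - b W` vanishes as well; the sum isolates `a`. -/
theorem cx_eq_zero (H : IsQuaternionicClifford Q c W) {e : E} (he : ‖e‖ = 1) {a b : ℍ[ℝ]}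
    (h : cx Q W a b = 0) : a = 0 ∧ b = 0 := by
  have h1 : cx Q W a (-b) = 0 := by
    rw [← mul_one (cx Q W a (-b)), ← H.sq_of_norm he, ← mul_assoc, ← H.vec_mul_cx, h, mul_zero,
      zero_mul]
  have hWW : ∀ x, x * W = 0 → x = 0 := fun x hx => by
    rw [← neg_eq_zero, ← mul_one (-x), neg_mul, ← mul_neg, ← H.vol_sq, ← mul_assoc, hx, zero_mul]
  have ha : (2 : ℝ) • Q a = 0 := by
    rw [two_smul, ← add_zero (0 : R)]
    nth_rewrite 1 [← h]
    rw [← h1]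
    simp only [cx, map_neg]
    noncomm_ring
  have ha0 : Q a = 0 := (smul_eq_zero_iff_right (two_ne_zero)).mp ha
  have hb0 : Q b = 0 := hWW _ (by simpa [cx, ha0] using h)
  exact ⟨H.injective (by rw [ha0, map_zero]), H.injective (by rw [hb0, map_zero])⟩

theorem cx_inj (H : IsQuaternionicClifford Q c W) {e : E} (he : ‖e‖ = 1) {a b a' b' : ℍ[ℝ]}
    (h : cx Q W a b = cx Q W a' b') : a = a' ∧ b = b' := by
  have := H.cx_eq_zero he (a := a - a') (b := b - b') (by rw [← cx_sub, h, sub_self])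
  exact ⟨sub_eq_zero.mp this.1, sub_eq_zero.mp this.2⟩

/-- For orthonormal `e`, `f`, `g`, conjugation by `g e`. -/
theorem conj_vec_vec (H : IsQuaternionicClifford Q c W) {e f g : E} (hge : inner ℝ g e = 0)
    (hgf : inner ℝ g f = 0) (hef : inner ℝ e f = 0)
    (a₀ b₀ a₁ b₁ a₂ b₂ a₃ b₃ : ℍ[ℝ]) :
    c g * c e * (cx Q W a₀ b₀ + cx Q W a₁ b₁ * c e + cx Q W a₂ b₂ * c f
        + cx Q W a₃ b₃ * (c e * c f))
      = (cx Q W a₀ b₀ - cx Q W a₁ b₁ * c e + cx Q W a₂ b₂ * c f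
        - cx Q W a₃ b₃ * (c e * c f)) * (c g * c e) := by
  have h3 := H.anticomm_of_inner hge
  have h4 := H.anticomm_of_inner hgf
  have h5 := H.anticomm_of_inner hef
  have hk : ∀ a b, c g * c e * cx Q W a b = cx Q W a b * (c g * c e) := fun a b => by
    rw [mul_assoc, H.vec_mul_cx, ← mul_assoc, H.vec_mul_cx, neg_neg, mul_assoc]
  have he' : c g * c e * c e = -(c e * (c g * c e)) := by
    rw [← mul_assoc (c e), ← neg_mul, ← h3]
  have hf' : c g * c e * c f = c f * (c g * c e) := by
    rw [mul_assoc, h5, mul_neg, ← mul_assoc, h4]; noncomm_ring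
  have hef' : c g * c e * (c e * c f) = -(c e * c f * (c g * c e)) := by
    rw [← mul_assoc, he', neg_mul, mul_assoc, hf']; noncomm_ring
  have e1 : ∀ a b x y, c g * c e * x = y → c g * c e * (cx Q W a b * x) = cx Q W a b * y :=
    fun a b x y hxy => by rw [← mul_assoc, hk, mul_assoc, hxy]
  simp only [mul_add, add_mul, sub_mul]
  rw [hk, e1 _ _ _ _ he', e1 _ _ _ _ hf', e1 _ _ _ _ hef']
  noncomm_ring

/-- For orthonormal `e`, `f` (and a third orthonormal vector `g`), the elements `1`, `e`, `f`,
`e f` are independent over the algebra generated by the quaternions and `W`. -/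
theorem cx_independent (H : IsQuaternionicClifford Q c W) {e f g : E} (he : ‖e‖ = 1)
    (hf : ‖f‖ = 1) (hg : ‖g‖ = 1) (hge : inner ℝ g e = 0) (hgf : inner ℝ g f = 0)
    (hef : inner ℝ e f = 0) {a₀ b₀ a₁ b₁ a₂ b₂ a₃ b₃ : ℍ[ℝ]}
    (h : cx Q W a₀ b₀ + cx Q W a₁ b₁ * c e + cx Q W a₂ b₂ * c f
        + cx Q W a₃ b₃ * (c e * c f) = 0) :
    (a₀ = 0 ∧ b₀ = 0) ∧ (a₁ = 0 ∧ b₁ = 0) ∧ (a₂ = 0 ∧ b₂ = 0) ∧ (a₃ = 0 ∧ b₃ = 0) := by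
  have he2 := H.sq_of_norm he
  have hf2 := H.sq_of_norm hf
  have hg2 := H.sq_of_norm hg
  have hfe : inner ℝ f e = 0 := by rw [real_inner_comm, hef]
  have hcancel : ∀ (v : E), c v * c v = 1 → ∀ x : R, x * (c g * c v) = 0 → x = 0 := by
    intro v hv x hx
    calc x = x * (c g * (c v * c v) * c g) := by rw [hv, mul_one, hg2, mul_one]
      _ = x * (c g * c v) * (c v * c g) := by noncomm_ring
      _ = 0 := by rw [hx, zero_mul]
  -- Conjugations by `g e`, by `g f` and by both in succession fix the coefficients and change the
  -- signs of `e`, `f` and `e f` by the characters of a Klein four-group. The four resulting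
  -- relations separate the four terms; `g` is what allows an even product to flip just one of `e`,
  -- `f`.
  have hA := hcancel e he2 _ ((H.conj_vec_vec hge hgf hef a₀ b₀ a₁ b₁ a₂ b₂ a₃ b₃).symm.trans
    (by rw [h, mul_zero]))
  have hswap : ∀ a b, cx Q W a b * (c f * c e) = -(cx Q W a b * (c e * c f)) := fun a b => by
    rw [H.anticomm_of_inner hfe, mul_neg]
  have h' : cx Q W a₀ b₀ + cx Q W a₂ b₂ * c f + cx Q W a₁ b₁ * c e
        + cx Q W (-a₃) (-b₃) * (c f * c e) = 0 := by
    rw [hswap, ← h]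
    simp only [cx, map_neg]
    noncomm_ring
  have hB := hcancel f hf2 _
    ((H.conj_vec_vec hgf hge hfe a₀ b₀ a₂ b₂ a₁ b₁ (-a₃) (-b₃)).symm.trans
      (by rw [h', mul_zero]))
  have hB' : cx Q W a₀ b₀ + cx Q W a₁ b₁ * c e - cx Q W a₂ b₂ * c f
        - cx Q W a₃ b₃ * (c e * c f) = 0 := by
    rw [← hB, hswap]
    simp only [cx, map_neg]
    noncomm_ring
  have hC := hcancel e he2 _ ((H.conj_vec_vec hge hgf hef a₀ b₀ a₁ b₁ (-a₂) (-b₂)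
    (-a₃) (-b₃)).symm.trans (by
      rw [show cx Q W a₀ b₀ + cx Q W a₁ b₁ * c e + cx Q W (-a₂) (-b₂) * c f
        + cx Q W (-a₃) (-b₃) * (c e * c f) = cx Q W a₀ b₀ + cx Q W a₁ b₁ * c e
          - cx Q W a₂ b₂ * c f - cx Q W a₃ b₃ * (c e * c f) by
            simp only [cx, map_neg]; noncomm_ring, hB', mul_zero]))
  have hC' : cx Q W a₀ b₀ - cx Q W a₁ b₁ * c e - cx Q W a₂ b₂ * c f
        + cx Q W a₃ b₃ * (c e * c f) = 0 := by
    rw [← hC]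
    simp only [cx, map_neg]
    noncomm_ring
  have hfour : ∀ x : R, (4 : ℝ) • x = 0 → x = 0 := fun x hx =>
    (smul_eq_zero_iff_right (by norm_num)).mp hx
  have k0 : cx Q W a₀ b₀ = 0 := hfour _ (by
    linear_combination (norm := module) h + hA + hB' + hC')
  have k1 : cx Q W a₁ b₁ * c e = 0 := hfour _ (by
    linear_combination (norm := module) h - hA + hB' - hC')
  have k2 : cx Q W a₂ b₂ * c f = 0 := hfour _ (by
    linear_combination (norm := module) h + hA - hB' - hC')
  have k3 : cx Q W a₃ b₃ * (c e * c f) = 0 := hfour _ (by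
    linear_combination (norm := module) h - hA - hB' + hC')
  have k1' : cx Q W a₁ b₁ = 0 := by rw [← mul_one (cx _ _ _ _), ← he2, ← mul_assoc, k1, zero_mul]
  have k2' : cx Q W a₂ b₂ = 0 := by rw [← mul_one (cx _ _ _ _), ← hf2, ← mul_assoc, k2, zero_mul]
  have k3' : cx Q W a₃ b₃ = 0 := by
    have h1 : cx Q W a₃ b₃ * c e = 0 := by
      rw [← mul_one (_ * c e), ← hf2, ← mul_assoc, mul_assoc (cx Q W a₃ b₃), k3, zero_mul]
    rw [← mul_one (cx _ _ _ _), ← he2, ← mul_assoc, h1, zero_mul]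
  exact ⟨H.cx_eq_zero he k0, H.cx_eq_zero he k1', H.cx_eq_zero he k2', H.cx_eq_zero he k3'⟩

/-- Averaging an endomorphism that intertwines multiplication by the vectors orthogonal to `f`. -/
theorem exists_quaternion_of_intertwine (H : IsQuaternionicClifford Q c W) {f : E} (hf : ‖f‖ = 1)
    {X D : R} (h₁ : ∀ e, inner ℝ e f = 0 → c e * D = X * c e)
    (h₂ : ∀ e, inner ℝ e f = 0 → c e * X = D * c e) :
    ∃ h, X + D + c f * X * c f + c f * D * c f = (4 : ℝ) • Q h := by
  -- Vectors orthogonal to `f` exchange `X` with `D`, and also their conjugates by `f`, while `f`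
  -- exchanges each element with its conjugate. The total therefore commutes with every vector.
  obtain ⟨h, hh⟩ := H.schur (X + D + c f * X * c f + c f * D * c f) fun e => by
    have hf2 := H.sq_of_norm hf
    have hfc : c f * (X + D + c f * X * c f + c f * D * c f)
        = (X + D + c f * X * c f + c f * D * c f) * c f := by
      have e1 : ∀ Y, c f * (c f * Y * c f) = Y * c f := fun Y => by
        rw [← mul_assoc, ← mul_assoc, hf2, one_mul]
      have e2 : ∀ Y, c f * Y * c f * c f = c f * Y := fun Y => by
        rw [mul_assoc, hf2, mul_one]
      simp only [mul_add, add_mul, e1, e2]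
      abel
    have hperp : ∀ e, inner ℝ e f = 0 → c e * (X + D + c f * X * c f + c f * D * c f)
        = (X + D + c f * X * c f + c f * D * c f) * c e := by
      intro e hef
      have h3 := H.anticomm_of_inner hef
      have e1 : ∀ Y Y', c e * Y = Y' * c e → c e * (c f * Y * c f) = c f * Y' * c f * c e := by
        intro Y Y' hY
        calc c e * (c f * Y * c f) = (c e * c f) * Y * c f := by noncomm_ring
          _ = -(c f * (c e * Y) * c f) := by rw [h3]; noncomm_ring
          _ = -(c f * Y' * (c e * c f)) := by rw [hY]; noncomm_ring
          _ = _ := by rw [h3]; noncomm_ring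
      rw [mul_add, mul_add, mul_add, h₁ e hef, h₂ e hef, e1 _ _ (h₁ e hef), e1 _ _ (h₂ e hef)]
      noncomm_ring
    have hdec : e = (e - (inner ℝ e f : ℝ) • f) + (inner ℝ e f : ℝ) • f := by abel
    have hort : inner ℝ (e - (inner ℝ e f : ℝ) • f) f = 0 := by
      rw [inner_sub_left, real_inner_smul_left, real_inner_self_eq_norm_sq, hf]
      ring
    rw [hdec, map_add, add_mul, mul_add _ (c _), hperp _ hort, map_smul,
      smul_mul_assoc, mul_smul_comm, hfc]
  refine ⟨(1 / 4 : ℝ) • h, ?_⟩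
  rw [hh, map_smul, smul_smul]
  norm_num

/-- Right multiplication by `f`, `W` or `f W` sends an intertwined pair to another one, up to a sign
on the second member. The four averages of these pairs are the coefficients, and a signed
combination recovers `X` and `D`. -/
theorem exists_quaternions_of_intertwine (H : IsQuaternionicClifford Q c W) {f : E}
    (hf : ‖f‖ = 1) {X D : R} (h₁ : ∀ e, inner ℝ e f = 0 → c e * D = X * c e)
    (h₂ : ∀ e, inner ℝ e f = 0 → c e * X = D * c e) :
    ∃ α β γ δ : ℍ[ℝ],
      X = Q α + Q β * c f + Q γ * W + Q δ * c f * W ∧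
      D = Q α - Q β * c f - Q γ * W + Q δ * c f * W := by
  have hf2 := H.sq_of_norm hf
  have hff : ∀ x, c f * (c f * x) = x := fun x => by rw [← mul_assoc, hf2, one_mul]
  have hWf := H.vol_vec f
  have hWf' : ∀ x, W * (c f * x) = -(c f * (W * x)) := fun x => by
    rw [← mul_assoc, hWf, neg_mul, mul_assoc]
  have hWW := H.vol_sq
  obtain ⟨α, hα⟩ := H.exists_quaternion_of_intertwine hf h₁ h₂
  obtain ⟨β, hβ⟩ := H.exists_quaternion_of_intertwine hf (X := X * c f) (D := -(D * c f))
    (fun e he => by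
      rw [mul_neg, ← mul_assoc, h₁ e he, mul_assoc, H.anticomm_of_inner he]; noncomm_ring)
    (fun e he => by
      rw [← mul_assoc, h₂ e he, mul_assoc, H.anticomm_of_inner he]; noncomm_ring)
  obtain ⟨γ, hγ⟩ := H.exists_quaternion_of_intertwine hf (X := X * W) (D := -(D * W))
    (fun e he => by
      rw [mul_neg, ← mul_assoc, h₁ e he, mul_assoc X W, H.vol_vec]; noncomm_ring)
    (fun e he => by
      rw [← mul_assoc, h₂ e he, neg_mul, mul_assoc D W, H.vol_vec]; noncomm_ring)
  obtain ⟨δ, hδ⟩ := H.exists_quaternion_of_intertwine hf (X := X * c f * W) (D := D * c f * W)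
    (fun e he => by
      rw [← mul_assoc, ← mul_assoc, h₁ e he, mul_assoc X, H.anticomm_of_inner he,
        mul_assoc (X * c f), H.vol_vec]; noncomm_ring)
    (fun e he => by
      rw [← mul_assoc, ← mul_assoc, h₂ e he, mul_assoc D, H.anticomm_of_inner he,
        mul_assoc (D * c f), H.vol_vec]; noncomm_ring)
  have hβ' := congrArg (· * c f) hβ
  have hγ' := congrArg (· * W) hγ
  have hδ' := congrArg (· * (c f * W)) hδ
  simp only [add_mul, mul_assoc, neg_mul, mul_neg, hf2, hff, hWf, hWf', hWW, mul_one,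
    smul_mul_assoc, neg_neg] at hα hβ' hγ' hδ'
  have hfour : ∀ x y : R, (4 : ℝ) • x = (4 : ℝ) • y → x = y := fun x y hxy =>
    smul_right_injective R (by norm_num : (4 : ℝ) ≠ 0) hxy
  -- Only `γ` changes sign: `f` and `f W` square to `1`, but `W` squares to `-1`.
  refine ⟨α, β, -γ, δ, hfour _ _ ?_, hfour _ _ ?_⟩
  · simp only [smul_add, mul_assoc, map_neg, neg_mul, smul_neg]
    linear_combination (norm := module) hα + hβ' - hγ' + hδ'
  · simp only [smul_add, smul_sub, mul_assoc, map_neg, neg_mul, smul_neg]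
    linear_combination (norm := module) hα - hβ' + hγ' + hδ'

end IsQuaternionicClifford

end QuaternionicClifford


/-! ### Diagonal blocks and the quaternion equations for their commutators -/

/-- The quaternionic equations equivalent to the commutation relations of the Heisenberg
algebra. -/
structure IsQuaternionSolution {E : Type*} [AddCommGroup E] [Module ℝ E] (h₁ h₂ : ℍ[ℝ])
    (h₃ h₄ : E →ₗ[ℝ] ℍ[ℝ]) : Prop where
  sq_add_sq : h₁ * h₁ + h₂ * h₂ = 0
  commute : h₂ * h₁ - h₁ * h₂ = 0
  lie_fst : ∀ e, h₃ e * h₁ - h₁ * h₃ e - (h₄ e * h₂ + h₂ * h₄ e) = 0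
  lie_snd : ∀ e, h₃ e * h₂ - h₂ * h₃ e + (h₄ e * h₁ + h₁ * h₄ e) = 0
  lie_lie : ∀ e f, h₃ e * h₃ f - h₃ f * h₃ e - (h₄ e * h₄ f - h₄ f * h₄ e) = 0
  lie_mixed : ∀ e f, h₃ e * h₄ f - h₄ f * h₃ e + (h₄ e * h₃ f - h₃ f * h₄ e) = 0

section DiagonalBlocks

variable {E : Type*} [NormedAddCommGroup E] [InnerProductSpace ℝ E]
variable {R : Type*} [Ring R] [Algebra ℝ R]

/-- The upper diagonal block `½ (h₃(e) - h₁ e + h₂ e W + h₄(e) W)`. -/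
def diagUpper (Q : ℍ[ℝ] →ₐ[ℝ] R) (c : E →ₗ[ℝ] R) (W : R) (h₁ h₂ : ℍ[ℝ]) (h₃ h₄ : E →ₗ[ℝ] ℍ[ℝ]) :
    E →ₗ[ℝ] R :=
  (1 / 2 : ℝ) • (Q.toLinearMap ∘ₗ h₃ - LinearMap.mulLeft ℝ (Q h₁) ∘ₗ c
    + LinearMap.mulRight ℝ W ∘ₗ LinearMap.mulLeft ℝ (Q h₂) ∘ₗ c
    + LinearMap.mulRight ℝ W ∘ₗ Q.toLinearMap ∘ₗ h₄)

/-- The lower diagonal block `½ (h₃(e) + h₁ e + h₂ e W - h₄(e) W)`. -/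
def diagLower (Q : ℍ[ℝ] →ₐ[ℝ] R) (c : E →ₗ[ℝ] R) (W : R) (h₁ h₂ : ℍ[ℝ]) (h₃ h₄ : E →ₗ[ℝ] ℍ[ℝ]) :
    E →ₗ[ℝ] R :=
  (1 / 2 : ℝ) • (Q.toLinearMap ∘ₗ h₃ + LinearMap.mulLeft ℝ (Q h₁) ∘ₗ c
    + LinearMap.mulRight ℝ W ∘ₗ LinearMap.mulLeft ℝ (Q h₂) ∘ₗ c
    - LinearMap.mulRight ℝ W ∘ₗ Q.toLinearMap ∘ₗ h₄)

variable {Q : ℍ[ℝ] →ₐ[ℝ] R} {c : E →ₗ[ℝ] R} {W : R}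

theorem diagUpper_apply (h₁ h₂ : ℍ[ℝ]) (h₃ h₄ : E →ₗ[ℝ] ℍ[ℝ]) (e : E) :
    diagUpper Q c W h₁ h₂ h₃ h₄ e
      = (1 / 2 : ℝ) • (Q (h₃ e) - Q h₁ * c e + Q h₂ * c e * W + Q (h₄ e) * W) := rfl

theorem diagLower_apply (h₁ h₂ : ℍ[ℝ]) (h₃ h₄ : E →ₗ[ℝ] ℍ[ℝ]) (e : E) :
    diagLower Q c W h₁ h₂ h₃ h₄ e
      = (1 / 2 : ℝ) • (Q (h₃ e) + Q h₁ * c e + Q h₂ * c e * W - Q (h₄ e) * W) := rfl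

namespace IsQuaternionicClifford

theorem diagUpper_eq (H : IsQuaternionicClifford Q c W) (h₁ h₂ : ℍ[ℝ]) (h₃ h₄ : E →ₗ[ℝ] ℍ[ℝ])
    (e : E) : diagUpper Q c W h₁ h₂ h₃ h₄ e
      = (1 / 2 : ℝ) • (cx Q W (h₃ e) (h₄ e) - cx Q W h₁ h₂ * c e) := by
  rw [diagUpper_apply, cx, cx, add_mul, mul_assoc (Q h₂) W, H.vol_vec]
  congr 1
  noncomm_ring

theorem diagLower_eq (H : IsQuaternionicClifford Q c W) (h₁ h₂ : ℍ[ℝ]) (h₃ h₄ : E →ₗ[ℝ] ℍ[ℝ])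
    (e : E) : diagLower Q c W h₁ h₂ h₃ h₄ e
      = (1 / 2 : ℝ) • (cx Q W (h₃ e) (-h₄ e) + cx Q W h₁ (-h₂) * c e) := by
  rw [diagLower_apply, cx, cx, add_mul, map_neg, map_neg, neg_mul (Q h₂), neg_mul (Q h₂ * W),
    mul_assoc (Q h₂) W, H.vol_vec]
  congr 1
  noncomm_ring

theorem vec_mul_diagLower_sub (H : IsQuaternionicClifford Q c W) (h₁ h₂ : ℍ[ℝ])
    (h₃ h₄ : E →ₗ[ℝ] ℍ[ℝ]) (e f : E) :
    c e * diagLower Q c W h₁ h₂ h₃ h₄ f - diagUpper Q c W h₁ h₂ h₃ h₄ f * c e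
      = (inner ℝ e f : ℝ) • cx Q W h₁ h₂ := by
  have h : c e * (cx Q W (h₃ f) (-h₄ f) + cx Q W h₁ (-h₂) * c f)
      - (cx Q W (h₃ f) (h₄ f) - cx Q W h₁ h₂ * c f) * c e
      = cx Q W h₁ h₂ * (c e * c f + c f * c e) := by
    rw [mul_add, H.vec_mul_cx, ← mul_assoc (c e), H.vec_mul_cx, neg_neg, neg_neg]
    noncomm_ring
  rw [H.diagLower_eq, H.diagUpper_eq, mul_smul_comm, smul_mul_assoc, ← smul_sub, h,
    H.mul_add_swap, mul_smul_comm, mul_one, smul_smul]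
  congr 1
  ring

/-- All solutions of the equation `e d(f) - a(f) e = ⟨e, f⟩ Z`. -/
theorem exists_eq_diag (H : IsQuaternionicClifford Q c W) {ι : Type*} [Fintype ι] [Nonempty ι]
    (ε : OrthonormalBasis ι ℝ E) {a d : E →ₗ[ℝ] R} {Z : R}
    (h : ∀ e f, c e * d f - a f * c e = (inner ℝ e f : ℝ) • Z) :
    ∃ (h₁ h₂ : ℍ[ℝ]) (h₃ h₄ : E →ₗ[ℝ] ℍ[ℝ]), Z = cx Q W h₁ h₂ ∧
      a = diagUpper Q c W h₁ h₂ h₃ h₄ ∧ d = diagLower Q c W h₁ h₂ h₃ h₄ := by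
  have hdec : ∀ i, ∃ α β γ δ : ℍ[ℝ],
      a (ε i) = Q α + Q β * c (ε i) + Q γ * W + Q δ * c (ε i) * W ∧
      d (ε i) = Q α - Q β * c (ε i) - Q γ * W + Q δ * c (ε i) * W ∧
      Z = cx Q W ((-2 : ℝ) • β) ((2 : ℝ) • δ) := by
    intro i
    have hi : ‖ε i‖ = 1 := ε.orthonormal.1 i
    have h₁ : ∀ e, inner ℝ e (ε i) = 0 → c e * d (ε i) = a (ε i) * c e := fun e he => by
      have := h e (ε i)
      rwa [he, zero_smul, sub_eq_zero] at this
    -- A nonzero vector is invertible because its square is a positive scalar, so the intertwining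
    -- relation can be reversed.
    have h₂ : ∀ e, inner ℝ e (ε i) = 0 → c e * a (ε i) = d (ε i) * c e := fun e he => by
      rcases eq_or_ne e 0 with rfl | he0
      · simp
      · have h2 : c e * c e = (inner ℝ e e : ℝ) • 1 := by
          have := H.mul_add_swap e e
          rw [← two_smul ℝ, mul_smul] at this
          exact smul_right_injective R (two_ne_zero' ℝ) this
        have h3 : (inner ℝ e e : ℝ) ≠ 0 := by simpa using he0
        refine smul_right_injective R h3 ?_
        calc (inner ℝ e e : ℝ) • (c e * a (ε i)) = c e * (a (ε i) * (c e * c e)) := by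
              rw [h2]; simp
          _ = c e * c e * (d (ε i) * c e) := by
              rw [← mul_assoc (a (ε i)), ← h₁ e he]; noncomm_ring
          _ = _ := by rw [h2]; simp
    obtain ⟨α, β, γ, δ, hX, hD⟩ := H.exists_quaternions_of_intertwine hi h₁ h₂
    refine ⟨α, β, γ, δ, hX, hD, ?_⟩
    have h3 := h (ε i) (ε i)
    rw [real_inner_self_eq_norm_sq, hi, one_pow, one_smul] at h3
    have hf2 := H.sq_of_norm hi
    have hWf := H.vol_vec (ε i)
    have k : ∀ q, c (ε i) * Q q = Q q * c (ε i) := H.vec_mul (ε i)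
    have k' : ∀ q x, c (ε i) * (Q q * x) = Q q * (c (ε i) * x) := fun q x => by
      rw [← mul_assoc, k, mul_assoc]
    have hff : ∀ x, c (ε i) * (c (ε i) * x) = x := fun x => by rw [← mul_assoc, hf2, one_mul]
    rw [← h3, hX, hD, cx, map_smul, map_smul]
    simp only [mul_add, mul_sub, add_mul, mul_assoc, k, k', hf2, hff, hWf, mul_neg, mul_one,
      smul_mul_assoc]
    module
  choose α β γ δ ha hd hZ using hdec
  obtain ⟨i₀⟩ := ‹Nonempty ι›
  refine ⟨(-2 : ℝ) • β i₀, (2 : ℝ) • δ i₀, ε.toBasis.constr ℝ fun i => (2 : ℝ) • α i,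
    ε.toBasis.constr ℝ fun i => (2 : ℝ) • γ i, hZ i₀, ?_, ?_⟩
  all_goals
    refine ε.toBasis.ext fun i => ?_
    -- `β` and `δ` are determined by the common element `Z`, so they do not depend on the basis
    -- vector; `α` and `γ` may vary and become linear maps.
    have hc := H.cx_inj (ε.orthonormal.1 i₀) ((hZ i).symm.trans (hZ i₀))
    have h1 := ε.toBasis.constr_basis ℝ (fun i => (2 : ℝ) • α i) i
    have h2 := ε.toBasis.constr_basis ℝ (fun i => (2 : ℝ) • γ i) i
    rw [OrthonormalBasis.coe_toBasis] at h1 h2 ⊢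
    first
    | rw [diagUpper_apply, h1, h2, ← hc.1, ← hc.2, ha]
    | rw [diagLower_apply, h1, h2, ← hc.1, ← hc.2, hd]
    simp only [map_smul, smul_mul_assoc]
    module

theorem upper_mul_upper (H : IsQuaternionicClifford Q c W) (h₁ h₂ a b a' b' : ℍ[ℝ]) (e f : E) :
    (cx Q W a b - cx Q W h₁ h₂ * c e) * (cx Q W a' b' - cx Q W h₁ h₂ * c f)
      = cx Q W (a * a' - b * b') (a * b' + b * a')
        - cx Q W (a * h₁ - b * h₂) (a * h₂ + b * h₁) * c f
        - cx Q W (h₁ * a' + h₂ * b') (h₂ * a' - h₁ * b') * c e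
        + cx Q W (h₁ * h₁ + h₂ * h₂) (h₂ * h₁ - h₁ * h₂) * (c e * c f) := by
  have h1 : cx Q W h₁ h₂ * c e * cx Q W a' b'
      = cx Q W (h₁ * a' + h₂ * b') (h₂ * a' - h₁ * b') * c e := by
    rw [mul_assoc, H.vec_mul_cx, ← mul_assoc, H.cx_mul]
    congr 2 <;> noncomm_ring
  have h2 : cx Q W h₁ h₂ * c e * (cx Q W h₁ h₂ * c f)
      = cx Q W (h₁ * h₁ + h₂ * h₂) (h₂ * h₁ - h₁ * h₂) * (c e * c f) := by
    rw [mul_assoc, ← mul_assoc (c e), H.vec_mul_cx, mul_assoc, ← mul_assoc, H.cx_mul]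
    congr 2 <;> noncomm_ring
  rw [sub_mul, mul_sub, mul_sub, H.cx_mul, ← mul_assoc (cx Q W a b), H.cx_mul, h1, h2]
  abel

/-- The commutator is sorted by `1, e, f, ef`, so that `cx_independent` can read the quaternion
equations off its coefficients. The factor `4` clears the two halves. -/
theorem lie_diagUpper (H : IsQuaternionicClifford Q c W) (h₁ h₂ : ℍ[ℝ])
    (h₃ h₄ : E →ₗ[ℝ] ℍ[ℝ]) (e f : E) :
    (4 : ℝ) • (diagUpper Q c W h₁ h₂ h₃ h₄ e * diagUpper Q c W h₁ h₂ h₃ h₄ f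
      - diagUpper Q c W h₁ h₂ h₃ h₄ f * diagUpper Q c W h₁ h₂ h₃ h₄ e)
    = cx Q W (h₃ e * h₃ f - h₃ f * h₃ e - (h₄ e * h₄ f - h₄ f * h₄ e))
        (h₃ e * h₄ f - h₄ f * h₃ e + (h₄ e * h₃ f - h₃ f * h₄ e))
      + cx Q W (h₃ f * h₁ - h₁ * h₃ f - (h₄ f * h₂ + h₂ * h₄ f))
          (h₃ f * h₂ - h₂ * h₃ f + (h₄ f * h₁ + h₁ * h₄ f)) * c e
      - cx Q W (h₃ e * h₁ - h₁ * h₃ e - (h₄ e * h₂ + h₂ * h₄ e))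
          (h₃ e * h₂ - h₂ * h₃ e + (h₄ e * h₁ + h₁ * h₄ e)) * c f
      + cx Q W (h₁ * h₁ + h₂ * h₂) (h₂ * h₁ - h₁ * h₂) * (c e * c f - c f * c e) := by
  rw [H.diagUpper_eq, H.diagUpper_eq, smul_mul_smul_comm, smul_mul_smul_comm, ← smul_sub,
    smul_smul, H.upper_mul_upper, H.upper_mul_upper]
  norm_num
  simp only [cx, map_add, map_sub, mul_sub, sub_mul, add_mul]
  abel

/-- The lower block is the upper one with `h₁, h₄` negated, and the system of quaternion equations
is invariant under this change. -/
theorem lie_diagLower (H : IsQuaternionicClifford Q c W) {h₁ h₂ : ℍ[ℝ]}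
    {h₃ h₄ : E →ₗ[ℝ] ℍ[ℝ]} (hs : IsQuaternionSolution h₁ h₂ h₃ h₄) (e f : E) :
    diagLower Q c W h₁ h₂ h₃ h₄ e * diagLower Q c W h₁ h₂ h₃ h₄ f
      = diagLower Q c W h₁ h₂ h₃ h₄ f * diagLower Q c W h₁ h₂ h₃ h₄ e := by
  have hs' : IsQuaternionSolution (-h₁) h₂ h₃ (-h₄) :=
    { sq_add_sq := by rw [← hs.sq_add_sq]; noncomm_ring
      commute := by rw [← neg_zero, ← hs.commute]; noncomm_ring
      lie_fst := fun e => by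
        rw [← neg_zero, ← hs.lie_fst e, LinearMap.neg_apply]; noncomm_ring
      lie_snd := fun e => by rw [← hs.lie_snd e, LinearMap.neg_apply]; noncomm_ring
      lie_lie := fun e f => by
        rw [← hs.lie_lie e f, LinearMap.neg_apply, LinearMap.neg_apply]; noncomm_ring
      lie_mixed := fun e f => by
        rw [← neg_zero, ← hs.lie_mixed e f, LinearMap.neg_apply, LinearMap.neg_apply]
        noncomm_ring }
  have h := H.lie_diagUpper (-h₁) h₂ h₃ (-h₄) e f
  rw [hs'.sq_add_sq, hs'.commute, hs'.lie_fst, hs'.lie_fst, hs'.lie_snd, hs'.lie_snd, hs'.lie_lie,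
    hs'.lie_mixed, cx_zero] at h
  have heq : diagLower Q c W h₁ h₂ h₃ h₄ = diagUpper Q c W (-h₁) h₂ h₃ (-h₄) := by
    ext e
    rw [diagLower_apply, diagUpper_apply, map_neg, LinearMap.neg_apply, map_neg]
    congr 1
    noncomm_ring
  rw [heq]
  exact sub_eq_zero.mp ((smul_eq_zero_iff_right (by norm_num : (4 : ℝ) ≠ 0)).mp (by simpa using h))

theorem lie_diagUpper_eq_zero (H : IsQuaternionicClifford Q c W) {h₁ h₂ : ℍ[ℝ]}
    {h₃ h₄ : E →ₗ[ℝ] ℍ[ℝ]} (hs : IsQuaternionSolution h₁ h₂ h₃ h₄) (e f : E) :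
    diagUpper Q c W h₁ h₂ h₃ h₄ e * diagUpper Q c W h₁ h₂ h₃ h₄ f
      = diagUpper Q c W h₁ h₂ h₃ h₄ f * diagUpper Q c W h₁ h₂ h₃ h₄ e := by
  have h := H.lie_diagUpper h₁ h₂ h₃ h₄ e f
  rw [hs.sq_add_sq, hs.commute, hs.lie_fst, hs.lie_fst, hs.lie_snd, hs.lie_snd, hs.lie_lie,
    hs.lie_mixed, cx_zero] at h
  exact sub_eq_zero.mp ((smul_eq_zero_iff_right (by norm_num : (4 : ℝ) ≠ 0)).mp (by simpa using h))

/-- This is the centrality of `p`. The equations for `h₁, h₂` say that `h₁ + h₂ W` annihilates its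
conjugate `h₁ - h₂ W`, and those linear in `h₃, h₄` say that it intertwines `h₃ - h₄ W` with `h₃ +
h₄ W`. -/
theorem cx_mul_diagLower (H : IsQuaternionicClifford Q c W) {h₁ h₂ : ℍ[ℝ]}
    {h₃ h₄ : E →ₗ[ℝ] ℍ[ℝ]} (hs : IsQuaternionSolution h₁ h₂ h₃ h₄) (e : E) :
    cx Q W h₁ h₂ * diagLower Q c W h₁ h₂ h₃ h₄ e
      = diagUpper Q c W h₁ h₂ h₃ h₄ e * cx Q W h₁ h₂ := by
  have hzz : cx Q W h₁ h₂ * cx Q W h₁ (-h₂) = 0 := by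
    have k1 : h₁ * h₁ - h₂ * -h₂ = 0 := by rw [← hs.sq_add_sq]; noncomm_ring
    have k2 : h₁ * -h₂ + h₂ * h₁ = 0 := by rw [← hs.commute]; noncomm_ring
    rw [H.cx_mul, k1, k2, cx_zero]
  have hzu : cx Q W h₁ h₂ * cx Q W (h₃ e) (-h₄ e) = cx Q W (h₃ e) (h₄ e) * cx Q W h₁ h₂ := by
    rw [H.cx_mul, H.cx_mul]
    have k1 := hs.lie_fst e
    have k2 := hs.lie_snd e
    congr 1
    · rw [← sub_eq_zero, ← neg_zero, ← k1]; noncomm_ring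
    · rw [← sub_eq_zero, ← neg_zero, ← k2]; noncomm_ring
  rw [H.diagLower_eq, H.diagUpper_eq, mul_smul_comm, smul_mul_assoc, mul_add, sub_mul, hzu,
    mul_assoc _ (c e), H.vec_mul_cx, ← mul_assoc, hzz]
  simp

/-- Three orthonormal vectors are needed for independence. Basis pairs give the coefficients of `e`
and `ef`; linearity extends the former to all vectors, after which only the constant term of the
commutator remains. -/
theorem isQuaternionSolution_of_commute (H : IsQuaternionicClifford Q c W) {m : ℕ} (hm : 3 ≤ m)
    (ε : OrthonormalBasis (Fin m) ℝ E) {h₁ h₂ : ℍ[ℝ]} {h₃ h₄ : E →ₗ[ℝ] ℍ[ℝ]}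
    (h : ∀ e f, diagUpper Q c W h₁ h₂ h₃ h₄ e * diagUpper Q c W h₁ h₂ h₃ h₄ f
      = diagUpper Q c W h₁ h₂ h₃ h₄ f * diagUpper Q c W h₁ h₂ h₃ h₄ e) :
    IsQuaternionSolution h₁ h₂ h₃ h₄ := by
  have hid : ∀ e f, _ := fun e f => (H.lie_diagUpper h₁ h₂ h₃ h₄ e f).symm.trans
    (by rw [h e f, sub_self, smul_zero])
  have hbasis : ∀ i, (h₁ * h₁ + h₂ * h₂ = 0 ∧ h₂ * h₁ - h₁ * h₂ = 0) ∧
      (h₃ (ε i) * h₁ - h₁ * h₃ (ε i) - (h₄ (ε i) * h₂ + h₂ * h₄ (ε i)) = 0 ∧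
        h₃ (ε i) * h₂ - h₂ * h₃ (ε i) + (h₄ (ε i) * h₁ + h₁ * h₄ (ε i)) = 0) := by
    intro i
    obtain ⟨j, hj⟩ : ∃ j, j ∉ ({i} : Finset (Fin m)) := by
      by_contra! hall
      have := Finset.card_le_card (fun j _ => hall j : Finset.univ ⊆ ({i} : Finset (Fin m)))
      simp at this
      omega
    obtain ⟨k, hk⟩ : ∃ k, k ∉ ({i, j} : Finset (Fin m)) := by
      by_contra! hall
      have := (Finset.card_le_card
        (fun j _ => hall j : Finset.univ ⊆ ({i, j} : Finset (Fin m)))).trans Finset.card_le_two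
      simp at this
      omega
    simp only [Finset.mem_singleton, Finset.mem_insert, not_or] at hj hk
    have ho := ε.orthonormal
    have hij : inner ℝ (ε j) (ε i) = 0 := ho.2 hj
    have h1 := hid (ε j) (ε i)
    have h2 : ∀ x : R, x * (c (ε j) * c (ε i) - c (ε i) * c (ε j))
        = (2 : ℝ) • (x * (c (ε j) * c (ε i))) := fun x => by
      rw [H.anticomm_of_inner (ho.2 (Ne.symm hj) : inner ℝ (ε i) (ε j) = 0), sub_neg_eq_add,
        two_smul, mul_add]
    have h3 : ∀ a b : ℍ[ℝ], ∀ x, (2 : ℝ) • (cx Q W a b * x)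
        = cx Q W ((2 : ℝ) • a) ((2 : ℝ) • b) * x := fun a b x => by
      simp only [cx, map_smul, smul_mul_assoc, ← smul_add]
    have h4 : ∀ a b : ℍ[ℝ], ∀ x y, y - cx Q W a b * x = y + cx Q W (-a) (-b) * x :=
        fun a b x y => by
      simp only [cx, map_neg]
      noncomm_ring
    rw [h2, h3, h4] at h1
    obtain ⟨-, h11, -, h33⟩ := H.cx_independent (ho.1 j) (ho.1 i) (ho.1 k)
      (ho.2 hk.2) (ho.2 hk.1) hij h1
    exact ⟨⟨(smul_eq_zero_iff_right two_ne_zero).mp h33.1,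
      (smul_eq_zero_iff_right two_ne_zero).mp h33.2⟩, h11⟩
  have hz := (hbasis ⟨0, by omega⟩).1
  have hfst : ∀ e, h₃ e * h₁ - h₁ * h₃ e - (h₄ e * h₂ + h₂ * h₄ e) = 0 := by
    have : (LinearMap.mulRight ℝ h₁ - LinearMap.mulLeft ℝ h₁) ∘ₗ h₃
        - (LinearMap.mulRight ℝ h₂ + LinearMap.mulLeft ℝ h₂) ∘ₗ h₄ = 0 :=
      ε.toBasis.ext fun i => by simpa using (hbasis i).2.1
    exact fun e => by simpa using LinearMap.congr_fun this e
  have hsnd : ∀ e, h₃ e * h₂ - h₂ * h₃ e + (h₄ e * h₁ + h₁ * h₄ e) = 0 := by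
    have : (LinearMap.mulRight ℝ h₂ - LinearMap.mulLeft ℝ h₂) ∘ₗ h₃
        + (LinearMap.mulRight ℝ h₁ + LinearMap.mulLeft ℝ h₁) ∘ₗ h₄ = 0 :=
      ε.toBasis.ext fun i => by simpa using (hbasis i).2.2
    exact fun e => by simpa using LinearMap.congr_fun this e
  have hlie : ∀ e f, _ := fun e f => H.cx_eq_zero (ε.orthonormal.1 ⟨0, by omega⟩)
    (a := h₃ e * h₃ f - h₃ f * h₃ e - (h₄ e * h₄ f - h₄ f * h₄ e))
    (b := h₃ e * h₄ f - h₄ f * h₃ e + (h₄ e * h₃ f - h₃ f * h₄ e)) (by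
      have h1 := hid e f
      rw [hz.1, hz.2, hfst, hfst, hsnd, hsnd, cx_zero] at h1
      simpa using h1)
  exact ⟨hz.1, hz.2, hfst, hsnd, fun e f => (hlie e f).1, fun e f => (hlie e f).2⟩

end IsQuaternionicClifford

end DiagonalBlocks


/-! ### Solving the quaternion equations by vector algebra -/

section QuaternionEquations

theorem norm_im_sq (q : ℍ[ℝ]) : ‖q.im‖ ^ 2 = q.imI ^ 2 + q.imJ ^ 2 + q.imK ^ 2 := by
  rw [pow_two, ← Quaternion.normSq_eq_norm_mul_self, Quaternion.normSq_def']
  simp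

theorem mem_imPerp_iff {n v : ℍ[ℝ]} : v ∈ imPerp n ↔
    v.re = 0 ∧ n.imI * v.imI + n.imJ * v.imJ + n.imK * v.imK = 0 := by
  change (v.re = 0 ∧ inner ℝ n.im v = 0) ↔ _
  rw [Quaternion.inner_def]
  simp

theorem im_ne_zero_iff {q : ℍ[ℝ]} : q.im ≠ 0 ↔ 0 < q.imI ^ 2 + q.imJ ^ 2 + q.imK ^ 2 := by
  rw [← norm_im_sq, sq_pos_iff, norm_ne_zero_iff]

@[simp] theorem re_imCross (a b : ℍ[ℝ]) : (imCross a b).re = 0 := rfl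

@[simp] theorem imI_imCross (a b : ℍ[ℝ]) :
    (imCross a b).imI = a.imJ * b.imK - a.imK * b.imJ := rfl

@[simp] theorem imJ_imCross (a b : ℍ[ℝ]) :
    (imCross a b).imJ = a.imK * b.imI - a.imI * b.imK := rfl

@[simp] theorem imK_imCross (a b : ℍ[ℝ]) :
    (imCross a b).imK = a.imI * b.imJ - a.imJ * b.imI := rfl

/-- The plane is strictly contained in the imaginary quaternions `imPerp 0`, themselves strictly
contained in a four-dimensional space. -/
theorem finrank_imPerp_le {n : ℍ[ℝ]} (hn : n.im ≠ 0) : Module.finrank ℝ (imPerp n) ≤ 2 := by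
  have h1 : imPerp n < imPerp 0 := by
    refine lt_of_le_of_ne (fun v hv => mem_imPerp_iff.mpr ?_) fun h => ?_
    · simpa using (mem_imPerp_iff.mp hv).1
    · have h2 : n.im ∈ imPerp 0 := mem_imPerp_iff.mpr (by simp)
      rw [← h, mem_imPerp_iff] at h2
      have h3 := im_ne_zero_iff.mp hn
      simp at h2
      nlinarith
  have h2 : imPerp 0 < ⊤ := by
    refine lt_of_le_of_ne le_top fun h => ?_
    have h3 : (1 : ℍ[ℝ]) ∈ imPerp 0 := by rw [h]; trivial
    simpa using (mem_imPerp_iff.mp h3).1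
  have h3 := Submodule.finrank_lt_finrank_of_lt h1
  have h4 := Submodule.finrank_lt_finrank_of_lt h2
  rw [finrank_top, Quaternion.finrank_eq_four] at h4
  omega

variable {E : Type*} [AddCommGroup E] [Module ℝ E]

/-- The relations between the values of `h₃` and of its rotation `h₄` about the axis `Im n` express
the condition on the image of `Im h₃`. -/
theorem imCondition_iff {n : ℍ[ℝ]} (hn : n.im ≠ 0) {k : ℝ}
    (hk : k ^ 2 * (n.imI ^ 2 + n.imJ ^ 2 + n.imK ^ 2) = 1) {h₃ h₄ : E →ₗ[ℝ] ℍ[ℝ]}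
    (h : ∀ e, h₄ e = k • imCross n (h₃ e)) :
    ((∀ e f, h₃ e * h₃ f - h₃ f * h₃ e - (h₄ e * h₄ f - h₄ f * h₄ e) = 0) ∧
      ∀ e f, h₃ e * h₄ f - h₄ f * h₃ e + (h₄ e * h₃ f - h₃ f * h₄ e) = 0) ↔
      ImCondition n h₃ := by
  have hk0 : k ^ 2 ≠ 0 := fun h0 => by rw [h0, zero_mul] at hk; exact zero_ne_one hk
  constructor
  · rintro ⟨hlie, -⟩
    -- With `v`, `w` the imaginary parts of `h₃ e`, `h₃ f`, the identity `(n × v) × (n × w) = (n ·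
    -- (v × w)) n` turns the relation into `v × w = k² (n · (v × w)) n`, written in components.
    have hcomp : ∀ e f,
        (h₃ e).imJ * (h₃ f).imK - (h₃ e).imK * (h₃ f).imJ = k ^ 2 *
          (n.imI * ((h₃ e).imJ * (h₃ f).imK - (h₃ e).imK * (h₃ f).imJ)
          + n.imJ * ((h₃ e).imK * (h₃ f).imI - (h₃ e).imI * (h₃ f).imK)
          + n.imK * ((h₃ e).imI * (h₃ f).imJ - (h₃ e).imJ * (h₃ f).imI)) * n.imI ∧
        (h₃ e).imK * (h₃ f).imI - (h₃ e).imI * (h₃ f).imK = k ^ 2 *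
          (n.imI * ((h₃ e).imJ * (h₃ f).imK - (h₃ e).imK * (h₃ f).imJ)
          + n.imJ * ((h₃ e).imK * (h₃ f).imI - (h₃ e).imI * (h₃ f).imK)
          + n.imK * ((h₃ e).imI * (h₃ f).imJ - (h₃ e).imJ * (h₃ f).imI)) * n.imJ ∧
        (h₃ e).imI * (h₃ f).imJ - (h₃ e).imJ * (h₃ f).imI = k ^ 2 *
          (n.imI * ((h₃ e).imJ * (h₃ f).imK - (h₃ e).imK * (h₃ f).imJ)
          + n.imJ * ((h₃ e).imK * (h₃ f).imI - (h₃ e).imI * (h₃ f).imK)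
          + n.imK * ((h₃ e).imI * (h₃ f).imJ - (h₃ e).imJ * (h₃ f).imI)) * n.imK := by
      intro e f
      have h1 := hlie e f
      rw [h e, h f, Quaternion.ext_iff] at h1
      obtain ⟨-, hI, hJ, hK⟩ := h1
      simp at hI hJ hK
      refine ⟨?_, ?_, ?_⟩
      · linear_combination hI / 2
      · linear_combination hJ / 2
      · linear_combination hK / 2
    by_cases hax : ∃ e, n.imI * (h₃ e).imI + n.imJ * (h₃ e).imJ + n.imK * (h₃ e).imK ≠ 0
    · left
      obtain ⟨e, he⟩ := hax
      have hle : LinearMap.range (imLin ∘ₗ h₃) ≤ Submodule.span ℝ {(h₃ e).im} := by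
        rintro _ ⟨f, rfl⟩
        obtain ⟨hI, hJ, hK⟩ := hcomp e f
        set T := n.imI * ((h₃ e).imJ * (h₃ f).imK - (h₃ e).imK * (h₃ f).imJ)
          + n.imJ * ((h₃ e).imK * (h₃ f).imI - (h₃ e).imI * (h₃ f).imK)
          + n.imK * ((h₃ e).imI * (h₃ f).imJ - (h₃ e).imJ * (h₃ f).imI) with hT
        -- Pairing the relation with `v`, which is orthogonal to `v × w` but not to `n`, kills the
        -- triple product; then `v × w = 0` for every `w` and the image lies on one line.
        have hT0 : T = 0 := by
          have : k ^ 2 * (T * (n.imI * (h₃ e).imI + n.imJ * (h₃ e).imJ + n.imK * (h₃ e).imK))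
              = 0 := by
            linear_combination -(h₃ e).imI * hI - (h₃ e).imJ * hJ - (h₃ e).imK * hK
          exact (mul_eq_zero.mp ((mul_eq_zero.mp this).resolve_left hk0)).resolve_right he
        rw [hT0, mul_zero, zero_mul] at hI hJ hK
        refine Submodule.mem_span_singleton.mpr
          ⟨(n.imI * (h₃ f).imI + n.imJ * (h₃ f).imJ + n.imK * (h₃ f).imK)
            / (n.imI * (h₃ e).imI + n.imJ * (h₃ e).imJ + n.imK * (h₃ e).imK), ?_⟩
        change _ = (h₃ f).im
        apply Quaternion.ext
        · simp
        · simp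
          field_simp
          linear_combination n.imJ * hK - n.imK * hJ
        · simp
          field_simp
          linear_combination n.imK * hI - n.imI * hK
        · simp
          field_simp
          linear_combination n.imI * hJ - n.imJ * hI
      refine (Submodule.finrank_mono hle).trans ?_
      simpa using finrank_span_le_card (R := ℝ) ({(h₃ e).im} : Set ℍ[ℝ])
    · push Not at hax
      have hle : LinearMap.range (imLin ∘ₗ h₃) ≤ imPerp n := by
        rintro _ ⟨e, rfl⟩
        refine mem_imPerp_iff.mpr ⟨?_, ?_⟩
        · change (h₃ e).im.re = 0
          simp
        · change n.imI * (h₃ e).im.imI + n.imJ * (h₃ e).im.imJ + n.imK * (h₃ e).im.imK = 0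
          simpa using hax e
      rcases Nat.lt_or_ge 1 (Module.finrank ℝ (LinearMap.range (imLin ∘ₗ h₃))) with h2 | h2
      · right
        exact Submodule.eq_of_le_of_finrank_le hle ((finrank_imPerp_le hn).trans h2)
      · exact Or.inl h2
  · rintro (h1 | hperp)
    · obtain ⟨v, hv⟩ := finrank_le_one_iff.mp h1
      have hv' : ∀ e, ∃ t : ℝ, (h₃ e).imI = t * (v : ℍ[ℝ]).imI ∧ (h₃ e).imJ = t * (v : ℍ[ℝ]).imJ ∧
          (h₃ e).imK = t * (v : ℍ[ℝ]).imK := fun e => by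
        obtain ⟨t, ht⟩ := hv ⟨_, LinearMap.mem_range_self _ e⟩
        have ht' : t • (v : ℍ[ℝ]) = (h₃ e).im := congrArg Subtype.val ht
        rw [Quaternion.ext_iff] at ht'
        simp at ht'
        exact ⟨t, ht'.2.1.symm, ht'.2.2.1.symm, ht'.2.2.2.symm⟩
      constructor <;> intro e f <;> obtain ⟨t, ha, hb, hc⟩ := hv' e <;>
        obtain ⟨t', ha', hb', hc'⟩ := hv' f <;> rw [h e, h f] <;> apply Quaternion.ext <;>
        simp [ha, hb, hc, ha', hb', hc'] <;> ring
    · have hv : ∀ e, n.imI * (h₃ e).imI + n.imJ * (h₃ e).imJ + n.imK * (h₃ e).imK = 0 := fun e => by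
        have h1 : (h₃ e).im ∈ imPerp n := by
          rw [← hperp]
          exact LinearMap.mem_range_self (imLin ∘ₗ h₃) e
        simpa using (mem_imPerp_iff.mp h1).2
      constructor <;> intro e f <;> have he := hv e <;> have hf := hv f <;> rw [h e, h f]
      · apply Quaternion.ext
        · simp
          ring
        · simp
          linear_combination
            (-2 * ((h₃ e).imJ * (h₃ f).imK - (h₃ e).imK * (h₃ f).imJ)) * hk
            + 2 * k ^ 2 * (n.imJ * ((h₃ f).imK * he - (h₃ e).imK * hf)
              - n.imK * ((h₃ f).imJ * he - (h₃ e).imJ * hf))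
        · simp
          linear_combination
            (-2 * ((h₃ e).imK * (h₃ f).imI - (h₃ e).imI * (h₃ f).imK)) * hk
            + 2 * k ^ 2 * (n.imK * ((h₃ f).imI * he - (h₃ e).imI * hf)
              - n.imI * ((h₃ f).imK * he - (h₃ e).imK * hf))
        · simp
          linear_combination
            (-2 * ((h₃ e).imI * (h₃ f).imJ - (h₃ e).imJ * (h₃ f).imI)) * hk
            + 2 * k ^ 2 * (n.imI * ((h₃ f).imJ * he - (h₃ e).imJ * hf)
              - n.imJ * ((h₃ f).imI * he - (h₃ e).imI * hf))
      · apply Quaternion.ext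
        · simp
          ring
        · simp
          linear_combination 2 * k * ((h₃ e).imI * hf - (h₃ f).imI * he)
        · simp
          linear_combination 2 * k * ((h₃ e).imJ * hf - (h₃ f).imJ * he)
        · simp
          linear_combination 2 * k * ((h₃ e).imK * hf - (h₃ f).imK * he)

theorem sq_mul_norm_im_sq {s : ℝ} (hs : s = 1 ∨ s = -1) {n : ℍ[ℝ]} (hn : n.im ≠ 0) :
    (s / ‖n.im‖) ^ 2 * (n.imI ^ 2 + n.imJ ^ 2 + n.imK ^ 2) = 1 := by
  have h0 : ‖n.im‖ ≠ 0 := norm_ne_zero_iff.mpr hn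
  rw [← norm_im_sq]
  field_simp
  rcases hs with rfl | rfl <;> norm_num

theorem FirstFamily.isQuaternionSolution {s : ℝ} (hs : s = 1 ∨ s = -1) {h₁ h₂ : ℍ[ℝ]}
    {h₃ h₄ : E →ₗ[ℝ] ℍ[ℝ]} (h : FirstFamily s h₁ h₂ h₃ h₄) :
    IsQuaternionSolution h₁ h₂ h₃ h₄ := by
  obtain ⟨hn, hcond, h1, h4⟩ := h
  have hlie := (imCondition_iff hn (sq_mul_norm_im_sq hs hn) h4).mpr hcond
  have hy0 : ‖h₂.im‖ ≠ 0 := norm_ne_zero_iff.mpr hn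
  have hy2 := norm_im_sq h₂
  have hs2 : s ^ 2 = 1 := by rcases hs with rfl | rfl <;> norm_num
  set y := ‖h₂.im‖
  -- Naming the inverse of `y` makes the remaining identities polynomial consequences of `s² = 1`,
  -- `k y = 1` and the formula for `y²`.
  obtain ⟨k, hk⟩ : ∃ k, k * y = 1 := ⟨y⁻¹, inv_mul_cancel₀ hy0⟩
  have hdiv : ∀ x : ℝ, x / y = x * k := fun x => by field_simp; linear_combination -x * hk
  have h1re : h₁.re = s * y := by rw [h1]; simp
  have h1I : h₁.imI = -s * h₂.re * k * h₂.imI := by rw [h1]; simp [hdiv]; ring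
  have h1J : h₁.imJ = -s * h₂.re * k * h₂.imJ := by rw [h1]; simp [hdiv]; ring
  have h1K : h₁.imK = -s * h₂.re * k * h₂.imK := by rw [h1]; simp [hdiv]; ring
  clear h1
  simp only [hdiv] at h4
  have hsk : s ^ 2 * k ^ 2 * (h₂.imI ^ 2 + h₂.imJ ^ 2 + h₂.imK ^ 2) = 1 := by
    rw [← hy2]
    linear_combination (k * y) ^ 2 * hs2 + (k * y + 1) * hk
  refine ⟨?_, ?_, fun e => ?_, fun e => ?_, hlie.1, hlie.2⟩
  · apply Quaternion.ext
    · simp [h1re, h1I, h1J, h1K]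
      linear_combination y ^ 2 * hs2 + hy2 - h₂.re ^ 2 * hsk
    · simp [h1re, h1I, h1J, h1K]
      linear_combination -2 * h₂.re * h₂.imI * (k * y) * hs2 - 2 * h₂.re * h₂.imI * hk
    · simp [h1re, h1I, h1J, h1K]
      linear_combination -2 * h₂.re * h₂.imJ * (k * y) * hs2 - 2 * h₂.re * h₂.imJ * hk
    · simp [h1re, h1I, h1J, h1K]
      linear_combination -2 * h₂.re * h₂.imK * (k * y) * hs2 - 2 * h₂.re * h₂.imK * hk
  · apply Quaternion.ext <;> simp [h1re, h1I, h1J, h1K] <;> ring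
  · rw [h4 e]
    apply Quaternion.ext <;> simp [h1re, h1I, h1J, h1K] <;> ring
  · rw [h4 e]
    apply Quaternion.ext
    · simp [h1re, h1I, h1J, h1K]
      ring
    · simp [h1re, h1I, h1J, h1K]
      linear_combination 2 * (h₂.imJ * (h₃ e).imK - h₂.imK * (h₃ e).imJ) * (k * y * hs2 + hk)
    · simp [h1re, h1I, h1J, h1K]
      linear_combination 2 * (h₂.imK * (h₃ e).imI - h₂.imI * (h₃ e).imK) * (k * y * hs2 + hk)
    · simp [h1re, h1I, h1J, h1K]
      linear_combination 2 * (h₂.imI * (h₃ e).imJ - h₂.imJ * (h₃ e).imI) * (k * y * hs2 + hk)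

theorem SecondFamily.isQuaternionSolution {s : ℝ} (hs : s = 1 ∨ s = -1) {h₁ h₂ : ℍ[ℝ]}
    {h₃ h₄ : E →ₗ[ℝ] ℍ[ℝ]} (h : SecondFamily s h₁ h₂ h₃ h₄) :
    IsQuaternionSolution h₁ h₂ h₃ h₄ := by
  obtain ⟨h1re, hn, hcond, h2, h4⟩ := h
  have hs' : -s = 1 ∨ -s = -1 := by rcases hs with rfl | rfl <;> simp
  have hlie := (imCondition_iff hn (sq_mul_norm_im_sq hs' hn) h4).mpr hcond
  have hy0 : ‖h₁.im‖ ≠ 0 := norm_ne_zero_iff.mpr hn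
  have hy2 := norm_im_sq h₁
  have hs2 : s ^ 2 = 1 := by rcases hs with rfl | rfl <;> norm_num
  set y := ‖h₁.im‖
  obtain ⟨k, hk⟩ : ∃ k, k * y = 1 := ⟨y⁻¹, inv_mul_cancel₀ hy0⟩
  have hdiv : ∀ x : ℝ, x / y = x * k := fun x => by field_simp; linear_combination -x * hk
  have h2re : h₂.re = s * y := by rw [h2]; simp
  have h2I : h₂.imI = 0 := by rw [h2]; simp
  have h2J : h₂.imJ = 0 := by rw [h2]; simp
  have h2K : h₂.imK = 0 := by rw [h2]; simp
  clear h2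
  simp only [hdiv] at h4
  refine ⟨?_, ?_, fun e => ?_, fun e => ?_, hlie.1, hlie.2⟩
  · apply Quaternion.ext
    · simp [h1re, h2re, h2I, h2J, h2K]
      linear_combination y ^ 2 * hs2 + hy2
    all_goals
      simp [h1re, h2re, h2I, h2J, h2K]
      ring
  · apply Quaternion.ext <;> simp [h1re, h2re, h2I, h2J, h2K] <;> ring
  · rw [h4 e]
    apply Quaternion.ext
    · simp [h1re, h2re, h2I, h2J, h2K]
      ring
    · simp [h1re, h2re, h2I, h2J, h2K]
      linear_combination 2 * (h₁.imJ * (h₃ e).imK - h₁.imK * (h₃ e).imJ) * (k * y * hs2 + hk)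
    · simp [h1re, h2re, h2I, h2J, h2K]
      linear_combination 2 * (h₁.imK * (h₃ e).imI - h₁.imI * (h₃ e).imK) * (k * y * hs2 + hk)
    · simp [h1re, h2re, h2I, h2J, h2K]
      linear_combination 2 * (h₁.imI * (h₃ e).imJ - h₁.imJ * (h₃ e).imI) * (k * y * hs2 + hk)
  · rw [h4 e]
    apply Quaternion.ext <;> simp [h1re, h2re, h2I, h2J, h2K] <;> ring

theorem IsParameter.isQuaternionSolution {h₁ h₂ : ℍ[ℝ]} {h₃ h₄ : E →ₗ[ℝ] ℍ[ℝ]}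
    (h : IsParameter h₁ h₂ h₃ h₄) : IsQuaternionSolution h₁ h₂ h₃ h₄ := by
  obtain ⟨s, hs, h | h⟩ := h
  · exact h.isQuaternionSolution hs
  · exact h.isQuaternionSolution hs

theorem IsParameter.ne_zero {h₁ h₂ : ℍ[ℝ]} {h₃ h₄ : E →ₗ[ℝ] ℍ[ℝ]}
    (h : IsParameter h₁ h₂ h₃ h₄) : h₁ ≠ 0 ∨ h₂ ≠ 0 := by
  obtain ⟨s, hs, h | h⟩ := h
  · exact Or.inr fun h0 => h.1 (by simp [h0])
  · exact Or.inl fun h0 => h.2.1 (by simp [h0])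

/-- Commuting with `h₂` makes `Im h₁` a multiple `t` of `Im h₂`. The quadratic equation then gives
`Re h₁ = ±|Im h₂|` and determines `t`. As `Re h₁ ≠ 0`, the equation `lie_snd` can be solved for
`h₄`. -/
theorem IsQuaternionSolution.firstFamily {h₁ h₂ : ℍ[ℝ]} {h₃ h₄ : E →ₗ[ℝ] ℍ[ℝ]}
    (h : IsQuaternionSolution h₁ h₂ h₃ h₄) (hn : h₂.im ≠ 0) :
    ∃ s : ℝ, (s = 1 ∨ s = -1) ∧ FirstFamily s h₁ h₂ h₃ h₄ := by
  have hy0 : 0 < ‖h₂.im‖ := norm_pos_iff.mpr hn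
  have hy2 := norm_im_sq h₂
  obtain ⟨-, hI, hJ, hK⟩ := Quaternion.ext_iff.mp h.commute
  obtain ⟨qr, qI, qJ, qK⟩ := Quaternion.ext_iff.mp h.sq_add_sq
  simp at hI hJ hK qr qI qJ qK
  set y := ‖h₂.im‖ with hy
  set t := (h₁.imI * h₂.imI + h₁.imJ * h₂.imJ + h₁.imK * h₂.imK) / y ^ 2 with ht
  have ht' : t * y ^ 2 = h₁.imI * h₂.imI + h₁.imJ * h₂.imJ + h₁.imK * h₂.imK := by
    rw [ht]; field_simp
  have hy20 : y ^ 2 ≠ 0 := by positivity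
  have h1I : h₁.imI = t * h₂.imI := mul_right_cancel₀ hy20 (by
    linear_combination h₁.imI * hy2 - h₂.imI * ht' - h₂.imJ * hK / 2 + h₂.imK * hJ / 2)
  have h1J : h₁.imJ = t * h₂.imJ := mul_right_cancel₀ hy20 (by
    linear_combination h₁.imJ * hy2 - h₂.imJ * ht' - h₂.imK * hI / 2 + h₂.imI * hK / 2)
  have h1K : h₁.imK = t * h₂.imK := mul_right_cancel₀ hy20 (by
    linear_combination h₁.imK * hy2 - h₂.imK * ht' - h₂.imI * hJ / 2 + h₂.imJ * hI / 2)
  rw [h1I, h1J, h1K] at qr qI qJ qK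
  have hx : h₁.re * t = -h₂.re := mul_right_cancel₀ hy20 (by
    linear_combination (h₁.re * t + h₂.re) * hy2 + h₂.imI * qI / 2 + h₂.imJ * qJ / 2
      + h₂.imK * qK / 2)
  have hre : h₁.re ^ 2 = y ^ 2 := by
    have h1 : (h₁.re ^ 2 - y ^ 2) * (1 + t ^ 2) = 0 := by
      linear_combination qr + (h₁.re * t - h₂.re) * hx - (1 + t ^ 2) * hy2
    have h2 : 1 + t ^ 2 ≠ 0 := by positivity
    linarith [(mul_eq_zero.mp h1).resolve_right h2]
  obtain ⟨s, hs, hsy⟩ : ∃ s : ℝ, (s = 1 ∨ s = -1) ∧ h₁.re = s * y := by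
    rcases sq_eq_sq_iff_eq_or_eq_neg.mp hre with h1 | h1
    · exact ⟨1, Or.inl rfl, by linarith⟩
    · exact ⟨-1, Or.inr rfl, by linarith⟩
  have hs2 : s ^ 2 = 1 := by rcases hs with rfl | rfl <;> norm_num
  have htx : t = -s * h₂.re / y := by
    field_simp
    linear_combination s * hx - t * y * hs2 - s * t * hsy
  have h4 : ∀ e, h₄ e = (s / y) • imCross h₂ (h₃ e) := by
    intro e
    obtain ⟨er, eI, eJ, eK⟩ := Quaternion.ext_iff.mp (h.lie_snd e)
    simp [h1I, h1J, h1K] at er eI eJ eK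
    -- The component of `lie_snd` along `Im h₂`, where the cross product drops out; with the real
    -- part it forces `Re h₄ = 0`.
    have hdot : h₁.re * ((h₄ e).imI * h₂.imI + (h₄ e).imJ * h₂.imJ + (h₄ e).imK * h₂.imK)
        + (h₄ e).re * t * y ^ 2 = 0 := by
      linear_combination h₂.imI * eI / 2 + h₂.imJ * eJ / 2 + h₂.imK * eK / 2
        + (h₄ e).re * t * hy2
    have h0 : (h₄ e).re = 0 := by
      have h1 : (h₄ e).re * (h₁.re ^ 2 + t ^ 2 * y ^ 2) = 0 := by
        linear_combination h₁.re * er / 2 + t * hdot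
      rw [hre] at h1
      have h2 : y ^ 2 + t ^ 2 * y ^ 2 ≠ 0 := by positivity
      exact (mul_eq_zero.mp h1).resolve_right h2
    rw [h0, hsy] at eI eJ eK
    apply Quaternion.ext
    · simp [h0]
    · simp
      field_simp
      linear_combination s * eI / 2 - (h₄ e).imI * y * hs2
    · simp
      field_simp
      linear_combination s * eJ / 2 - (h₄ e).imJ * y * hs2
    · simp
      field_simp
      linear_combination s * eK / 2 - (h₄ e).imK * y * hs2
  refine ⟨s, hs, hn, (imCondition_iff hn (sq_mul_norm_im_sq hs hn) h4).mp
    ⟨h.lie_lie, h.lie_mixed⟩, ?_, h4⟩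
  rw [← hy]
  apply Quaternion.ext
  · simp [hsy]
  · simp [h1I, htx]; ring
  · simp [h1J, htx]; ring
  · simp [h1K, htx]; ring

/-- When `h₂` is real, `h₁²` is real and nonpositive, so `h₁` is imaginary of norm `|h₂|`, nonzero
by `hz`. Then `h₂` is invertible and `lie_fst` is solved for `h₄`. -/
theorem IsQuaternionSolution.secondFamily {h₁ h₂ : ℍ[ℝ]} {h₃ h₄ : E →ₗ[ℝ] ℍ[ℝ]}
    (h : IsQuaternionSolution h₁ h₂ h₃ h₄) (hz : h₁ ≠ 0 ∨ h₂ ≠ 0) (h2 : h₂.im = 0) :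
    ∃ s : ℝ, (s = 1 ∨ s = -1) ∧ SecondFamily s h₁ h₂ h₃ h₄ := by
  obtain ⟨-, h2I, h2J, h2K⟩ := Quaternion.ext_iff.mp h2
  obtain ⟨qr, qI, qJ, qK⟩ := Quaternion.ext_iff.mp h.sq_add_sq
  simp at h2I h2J h2K
  simp [h2I, h2J, h2K] at qr qI qJ qK
  have hn : h₁.im ≠ 0 := by
    intro h1
    obtain ⟨-, h1I, h1J, h1K⟩ := Quaternion.ext_iff.mp h1
    simp at h1I h1J h1K
    rw [h1I, h1J, h1K] at qr
    have hr1 : h₁.re = 0 := by nlinarith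
    have hr2 : h₂.re = 0 := by nlinarith
    rcases hz with hz | hz
    · exact hz (by apply Quaternion.ext <;> simp [*])
    · exact hz (by apply Quaternion.ext <;> simp [*])
  have hy0 : 0 < ‖h₁.im‖ := norm_pos_iff.mpr hn
  have hy2 := norm_im_sq h₁
  have hre : h₁.re = 0 := by
    have h1 : h₁.re * ‖h₁.im‖ ^ 2 = 0 := by
      rw [hy2]
      linear_combination h₁.imI * qI / 2 + h₁.imJ * qJ / 2 + h₁.imK * qK / 2
    exact (mul_eq_zero.mp h1).resolve_right (by positivity)
  set y := ‖h₁.im‖ with hy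
  have hx : h₂.re ^ 2 = y ^ 2 := by
    rw [hre] at qr
    linear_combination qr - hy2
  obtain ⟨s, hs, hsy⟩ : ∃ s : ℝ, (s = 1 ∨ s = -1) ∧ h₂.re = s * y := by
    rcases sq_eq_sq_iff_eq_or_eq_neg.mp hx with h1 | h1
    · exact ⟨1, Or.inl rfl, by linarith⟩
    · exact ⟨-1, Or.inr rfl, by linarith⟩
  have hs' : -s = 1 ∨ -s = -1 := by rcases hs with rfl | rfl <;> simp
  have hs2 : s ^ 2 = 1 := by rcases hs with rfl | rfl <;> norm_num
  have hs0 : s ≠ 0 := by rcases hs with rfl | rfl <;> norm_num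
  have h4 : ∀ e, h₄ e = (-s / y) • imCross h₁ (h₃ e) := by
    intro e
    obtain ⟨er, eI, eJ, eK⟩ := Quaternion.ext_iff.mp (h.lie_fst e)
    simp [h2I, h2J, h2K, hre, hsy] at er eI eJ eK
    have h0 : (h₄ e).re = 0 := by
      have h1 : (h₄ e).re * (s * y) = 0 := by linear_combination -er / 2
      exact (mul_eq_zero.mp h1).resolve_right (mul_ne_zero hs0 hy0.ne')
    apply Quaternion.ext
    · simp [h0]
    · simp
      field_simp
      linear_combination -s * eI / 2 - (h₄ e).imI * y * hs2
    · simp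
      field_simp
      linear_combination -s * eJ / 2 - (h₄ e).imJ * y * hs2
    · simp
      field_simp
      linear_combination -s * eK / 2 - (h₄ e).imK * y * hs2
  refine ⟨s, hs, hre, hn, (imCondition_iff hn (sq_mul_norm_im_sq hs' hn) h4).mp
    ⟨h.lie_lie, h.lie_mixed⟩, ?_, h4⟩
  rw [← hy]
  apply Quaternion.ext <;> simp [hsy, h2I, h2J, h2K]

theorem IsQuaternionSolution.isParameter {h₁ h₂ : ℍ[ℝ]} {h₃ h₄ : E →ₗ[ℝ] ℍ[ℝ]}
    (h : IsQuaternionSolution h₁ h₂ h₃ h₄) (hz : h₁ ≠ 0 ∨ h₂ ≠ 0) :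
    IsParameter h₁ h₂ h₃ h₄ := by
  by_cases h2 : h₂.im = 0
  · obtain ⟨s, hs, h⟩ := h.secondFamily hz h2
    exact ⟨s, hs, Or.inr h⟩
  · obtain ⟨s, hs, h⟩ := h.firstFamily h2
    exact ⟨s, hs, Or.inl h⟩

end QuaternionEquations


/-! ### The volume form, and the spinor module as an instance of the abstract setting -/

section VolumeForm

variable {E : Type*} [NormedAddCommGroup E] [InnerProductSpace ℝ E]
variable {S₀ : Type*} [AddCommGroup S₀] [Module ℝ S₀] [Module (ClE E) S₀]
  [IsScalarTower ℝ (ClE E) S₀]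

theorem cl_volumeForm {m : ℕ} (ε : OrthonormalBasis (Fin m) ℝ E) :
    cl S₀ (volumeForm ε) = monomial (fun i => clMul S₀ (ε i)) (List.finRange m) := by
  rw [volumeForm, map_list_prod, List.ofFn_eq_map, List.map_map, monomial]
  rfl

theorem cl_volumeForm_mul_clMul {m : ℕ} (hm : Even m) (ε : OrthonormalBasis (Fin m) ℝ E) (e : E) :
    cl S₀ (volumeForm ε) * clMul S₀ e = -(clMul S₀ e * cl S₀ (volumeForm ε)) := by
  have h : ∀ i, cl S₀ (volumeForm ε) * clMul S₀ (ε i)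
      = -(clMul S₀ (ε i) * cl S₀ (volumeForm ε)) := fun i => by
    have h1 := (clMul_isCliffordFamily (S₀ := S₀) ε.orthonormal).mul_monomial_of_mem
      (List.nodup_finRange m) (List.mem_finRange i)
    rw [List.length_finRange, hm.add_one.neg_one_pow, neg_one_smul] at h1
    rw [cl_volumeForm, h1, neg_neg]
  rw [clMul_eq_sum ε e, Finset.mul_sum, Finset.sum_mul, ← Finset.sum_neg_distrib]
  refine Finset.sum_congr rfl fun i _ => ?_
  rw [mul_smul_comm, smul_mul_assoc, h, smul_neg]

theorem cl_volumeForm_mul_self {m : ℕ} (hm : m ≡ 6 [MOD 8]) (ε : OrthonormalBasis (Fin m) ℝ E) :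
    cl S₀ (volumeForm ε) * cl S₀ (volumeForm ε) = -1 := by
  have hodd : Odd (m.choose 2) := by
    have hm' : m % 8 = 6 := hm
    obtain ⟨t, rfl⟩ : ∃ t, m = 8 * t + 6 := ⟨m / 8, by omega⟩
    rw [Nat.choose_two_right, show 8 * t + 6 - 1 = 8 * t + 5 by omega,
      show (8 * t + 6) * (8 * t + 5) = 2 * (2 * (16 * t ^ 2 + 22 * t + 7) + 1) by ring,
      Nat.mul_div_cancel_left _ (by norm_num)]
    exact ⟨_, rfl⟩
  rw [cl_volumeForm, (clMul_isCliffordFamily (S₀ := S₀) ε.orthonormal).monomial_mul_self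
    (List.nodup_finRange m), List.length_finRange, hodd.neg_one_pow, neg_one_smul]

theorem commute_cl_of_mem_evenSchur {x : Module.End ℝ S₀} (hx : x ∈ evenSchur E S₀) (a : ClE E) :
    cl S₀ a * x = x * cl S₀ a := by
  induction a using CliffordAlgebra.induction with
  | algebraMap r => rw [AlgHom.commutes, Algebra.commutes]
  | ι e => exact mem_evenSchur_iff.mp hx e
  | mul a b ha hb => rw [map_mul, mul_assoc, hb, ← mul_assoc, ha, mul_assoc]
  | add a b ha hb => rw [map_add, add_mul, mul_add, ha, hb]

/-- The residue of `m` enters through the volume form: it anticommutes with vectors as `m` is even,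
and squares to `-1` as `m.choose 2` is odd. -/
theorem isQuaternionicClifford {m : ℕ} (hm : m ≡ 6 [MOD 8])
    (ε : OrthonormalBasis (Fin m) ℝ E) (Φ : ℍ[ℝ] ≃ₐ[ℝ] evenSchur E S₀) :
    IsQuaternionicClifford (qAct Φ) (clMul S₀ : E →ₗ[ℝ] Module.End ℝ S₀)
      (cl S₀ (volumeForm ε)) where
  mul_add_swap := clMul_mul_add_swap
  vec_mul e h := mem_evenSchur_iff.mp (Φ h).2 e
  vol_mul h := commute_cl_of_mem_evenSchur (Φ h).2 _
  vol_vec := cl_volumeForm_mul_clMul (by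
    have hm' : m % 8 = 6 := hm
    exact Nat.even_iff.mpr (by omega)) ε
  vol_sq := cl_volumeForm_mul_self hm ε
  injective := Subtype.val_injective.comp Φ.injective
  schur x hx := ⟨Φ.symm ⟨x, mem_evenSchur_iff.mpr hx⟩, by
    change x = ((Φ (Φ.symm ⟨x, mem_evenSchur_iff.mpr hx⟩) : evenSchur E S₀) : Module.End ℝ S₀)
    rw [AlgEquiv.apply_symm_apply]⟩

theorem rho11_eq_diagUpper (Φ : ℍ[ℝ] ≃ₐ[ℝ] evenSchur E S₀) (ω : ClE E) (h₁ h₂ : ℍ[ℝ])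
    (h₃ h₄ : E →ₗ[ℝ] ℍ[ℝ]) : rho11 Φ ω h₁ h₂ h₃ h₄
      = diagUpper (qAct Φ) (clMul S₀) (cl S₀ ω) h₁ h₂ h₃ h₄ := rfl

theorem rho22_eq_diagLower (Φ : ℍ[ℝ] ≃ₐ[ℝ] evenSchur E S₀) (ω : ClE E) (h₁ h₂ : ℍ[ℝ])
    (h₃ h₄ : E →ₗ[ℝ] ℍ[ℝ]) : rho22 Φ ω h₁ h₂ h₃ h₄
      = diagLower (qAct Φ) (clMul S₀) (cl S₀ ω) h₁ h₂ h₃ h₄ := rfl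

end VolumeForm

/-! ### Block matrices on the doubled spinor space -/

section Blocks

variable {S₀ : Type*} [AddCommGroup S₀] [Module ℝ S₀]

theorem block_mul (a b c d a' b' c' d' : Module.End ℝ S₀) :
    block a b c d * block a' b' c' d'
      = block (a * a' + b * c') (a * b' + b * d') (c * a' + d * c') (c * b' + d * d') := by
  refine LinearMap.ext fun x => Prod.ext ?_ ?_ <;>
    simp [block, Module.End.mul_apply] <;> abel

theorem block_sub (a b c d a' b' c' d' : Module.End ℝ S₀) :
    block a b c d - block a' b' c' d' = block (a - a') (b - b') (c - c') (d - d') := by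
  refine LinearMap.ext fun x => Prod.ext ?_ ?_ <;> simp [block] <;> abel

theorem block_add (a b c d a' b' c' d' : Module.End ℝ S₀) :
    block a b c d + block a' b' c' d' = block (a + a') (b + b') (c + c') (d + d') := by
  refine LinearMap.ext fun x => Prod.ext ?_ ?_ <;> simp [block] <;> abel

theorem smul_block (r : ℝ) (a b c d : Module.End ℝ S₀) :
    r • block a b c d = block (r • a) (r • b) (r • c) (r • d) := by
  refine LinearMap.ext fun x => Prod.ext ?_ ?_ <;> simp [block]

theorem block_zero : block (0 : Module.End ℝ S₀) 0 0 0 = 0 := by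
  refine LinearMap.ext fun x => Prod.ext ?_ ?_ <;> simp [block]

theorem block_inj {a b c d a' b' c' d' : Module.End ℝ S₀} :
    block a b c d = block a' b' c' d' ↔ a = a' ∧ b = b' ∧ c = c' ∧ d = d' := by
  constructor
  · intro h
    have h1 : ∀ x y, a x + b y = a' x + b' y := fun x y =>
      congrArg Prod.fst (LinearMap.congr_fun h (x, y))
    have h2 : ∀ x y, c x + d y = c' x + d' y := fun x y =>
      congrArg Prod.snd (LinearMap.congr_fun h (x, y))
    refine ⟨?_, ?_, ?_, ?_⟩ <;> ext x
    · simpa using h1 x 0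
    · simpa using h1 0 x
    · simpa using h2 x 0
    · simpa using h2 0 x
  · rintro ⟨rfl, rfl, rfl, rfl⟩
    rfl

/-- The corner `π ∘ X ∘ ι` of an endomorphism, as a linear map in `X`. -/
def corner (π : S₀ × S₀ →ₗ[ℝ] S₀) (ι : S₀ →ₗ[ℝ] S₀ × S₀) :
    Module.End ℝ (S₀ × S₀) →ₗ[ℝ] Module.End ℝ S₀ where
  toFun X := π ∘ₗ X ∘ₗ ι
  map_add' X Y := by ext; simp
  map_smul' r X := by ext; simp

theorem eq_block_corner (X : Module.End ℝ (S₀ × S₀)) :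
    X = block (corner (LinearMap.fst ℝ S₀ S₀) (LinearMap.inl ℝ S₀ S₀) X)
      (corner (LinearMap.fst ℝ S₀ S₀) (LinearMap.inr ℝ S₀ S₀) X)
      (corner (LinearMap.snd ℝ S₀ S₀) (LinearMap.inl ℝ S₀ S₀) X)
      (corner (LinearMap.snd ℝ S₀ S₀) (LinearMap.inr ℝ S₀ S₀) X) := by
  refine LinearMap.ext fun x => ?_
  have h : x = LinearMap.inl ℝ S₀ S₀ x.1 + LinearMap.inr ℝ S₀ S₀ x.2 := by simp
  conv_lhs => rw [h, map_add]
  refine Prod.ext ?_ ?_ <;> simp [block, corner]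

/-- Vectors of `E` act with opposite signs on the two summands, so the two terms of the commutator
with `p` add up: `(2√2 + 2√2) / 4 = √2`. -/
theorem rhoSpin_wedge {E : Type*} [NormedAddCommGroup E] [InnerProductSpace ℝ E]
    [Module (ClE E) S₀] [IsScalarTower ℝ (ClE E) S₀] (e : E) :
    rhoSpin S₀ (wedge vecP (vecE e)) = block 0 (√2 • clMul S₀ e) 0 0 := by
  rw [wedge, map_smul, map_sub, map_mul, map_mul, rhoSpin, CliffordAlgebra.lift_ι_apply,
    CliffordAlgebra.lift_ι_apply]
  change (1 / 4 : ℝ) • (block _ _ _ _ * block _ _ _ _ - block _ _ _ _ * block _ _ _ _) = _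
  rw [block_mul, block_mul, block_sub, smul_block, block_inj]
  simp only [vecP, vecE, map_zero, neg_zero, mul_zero, zero_smul, zero_mul, add_zero, zero_add,
    mul_one, sub_self, smul_zero, true_and, and_true, smul_mul_assoc, one_mul, mul_smul_comm,
    mul_neg]
  module

end Blocks

/-! ### Spin representations in block form -/

section Representations

variable {E : Type*} [NormedAddCommGroup E] [InnerProductSpace ℝ E] [FiniteDimensional ℝ E]
variable {b : LinearMap.BilinForm ℝ E}

theorem bilin_eq_inner_opB (e f : E) : b e f = inner ℝ (opB b e) f := by
  rw [opB_spec, pairing_apply, neg_neg]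

theorem opB_surjective (hb : b.Nondegenerate) : Function.Surjective (opB b) := by
  rw [← LinearMap.injective_iff_surjective, ← LinearMap.ker_eq_bot, LinearMap.ker_eq_bot']
  intro e he
  refine hb.1 e fun f => ?_
  rw [bilin_eq_inner_opB, he, inner_zero_left]

namespace Heis

/-- The inclusion of `E` as a linear map. -/
def ofVecLinear (b : LinearMap.BilinForm ℝ E) : E →ₗ[ℝ] Heis b where
  toFun := ofVec b
  map_add' e f := by ext <;> simp [ofVec]
  map_smul' r e := by ext <;> simp [ofVec]

theorem lie_ofFlat_ofVec (e f : E) : ⁅ofFlat b e, ofVec b f⁆ = b e f • p b := by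
  ext <;> simp [ofFlat, ofVec, p]

theorem lie_ofVec_ofVec (e f : E) : ⁅ofVec b e, ofVec b f⁆ = 0 := by
  ext <;> simp [ofVec]

end Heis

variable {S₀ : Type*} [AddCommGroup S₀] [Module ℝ S₀] [Module (ClE E) S₀]
  [IsScalarTower ℝ (ClE E) S₀]

/-- The diagonal blocks of a spin representation satisfy the equation of `exists_eq_diag`, and the
lower left blocks vanish. -/
theorem IsSpin.block_relations (hb : b.Nondegenerate) {m : ℕ} (hm : 2 ≤ m)
    (ε : OrthonormalBasis (Fin m) ℝ E)
    {ρ : Heis b →ₗ⁅ℝ⁆ Module.End ℝ (S₀ × S₀)} (hρ : IsSpin ρ) :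
    ∃ (a r d : E →ₗ[ℝ] Module.End ℝ S₀) (Z : Module.End ℝ S₀),
      (∀ e, ρ (Heis.ofVec b e) = block (a e) (r e) 0 (d e)) ∧
      ρ (Heis.p b) = √2 • block 0 Z 0 0 ∧
      ∀ e f, clMul S₀ e * d f - a f * clMul S₀ e = (inner ℝ e f : ℝ) • Z := by
  set v := ρ.toLinearMap ∘ₗ Heis.ofVecLinear b with hv
  set a := corner (LinearMap.fst ℝ S₀ S₀) (LinearMap.inl ℝ S₀ S₀) ∘ₗ v
  set r := corner (LinearMap.fst ℝ S₀ S₀) (LinearMap.inr ℝ S₀ S₀) ∘ₗ v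
  set q := corner (LinearMap.snd ℝ S₀ S₀) (LinearMap.inl ℝ S₀ S₀) ∘ₗ v
  set d := corner (LinearMap.snd ℝ S₀ S₀) (LinearMap.inr ℝ S₀ S₀) ∘ₗ v
  have hblock : ∀ e, ρ (Heis.ofVec b e) = block (a e) (r e) (q e) (d e) := fun e =>
    eq_block_corner _
  obtain ⟨p₁₁, p₁₂, p₂₁, p₂₂, hp⟩ : ∃ p₁₁ p₁₂ p₂₁ p₂₂, ρ (Heis.p b) = block p₁₁ p₁₂ p₂₁ p₂₂ :=
    ⟨_, _, _, _, eq_block_corner _⟩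
  have hrel : ∀ e f,
      √2 • (clMul S₀ e * q f) = (inner ℝ e f : ℝ) • p₁₁ ∧
      √2 • (clMul S₀ e * d f - a f * clMul S₀ e) = (inner ℝ e f : ℝ) • p₁₂ ∧
      0 = (inner ℝ e f : ℝ) • p₂₁ ∧ -(√2 • (q f * clMul S₀ e)) = (inner ℝ e f : ℝ) • p₂₂ := by
    intro e f
    -- Substituting `B e'` for `e` turns `b` into the inner product, so `b` disappears from the
    -- relations.
    obtain ⟨e', rfl⟩ := opB_surjective hb e
    have h1 := congrArg ρ (Heis.lie_ofFlat_ofVec (b := b) e' f)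
    rw [LieHom.map_lie, map_smul, hρ e', rhoSpin_wedge, hblock, hp, Ring.lie_def, block_mul,
      block_mul, block_sub, smul_block, block_inj, bilin_eq_inner_opB] at h1
    simpa [smul_sub] using h1
  have h2 : √2 ≠ 0 := by positivity
  -- A basis vector orthogonal to `ε j` annihilates `q (ε j)` from the left, and it is invertible;
  -- this is where `2 ≤ m` is needed.
  have hq : q = 0 := by
    refine ε.toBasis.ext fun j => ?_
    obtain ⟨i, hij⟩ : ∃ i, i ≠ j := by
      have : Nontrivial (Fin m) := Fin.nontrivial_iff_two_le.mpr hm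
      exact exists_ne j
    have h1 := (hrel (ε i) (ε j)).1
    rw [ε.orthonormal.2 hij, zero_smul] at h1
    have h3 := (smul_eq_zero_iff_right h2).mp h1
    rw [OrthonormalBasis.coe_toBasis, LinearMap.zero_apply, ← one_mul (q (ε j)),
      ← (clMul_isCliffordFamily (S₀ := S₀) ε.orthonormal).sq i, mul_assoc, h3, mul_zero]
  have hi : inner ℝ (ε ⟨0, by omega⟩) (ε ⟨0, by omega⟩) = (1 : ℝ) := by
    rw [real_inner_self_eq_norm_sq, ε.orthonormal.1, one_pow]
  have hp' := hrel (ε ⟨0, by omega⟩) (ε ⟨0, by omega⟩)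
  rw [hi] at hp'
  simp only [hq, LinearMap.zero_apply, mul_zero, zero_mul, smul_zero, neg_zero, one_smul] at hp'
  refine ⟨a, r, d, (√2)⁻¹ • p₁₂, fun e => by rw [hblock, hq, LinearMap.zero_apply], ?_,
    fun e f => ?_⟩
  · rw [hp, smul_block, ← hp'.1, ← hp'.2.2.1, ← hp'.2.2.2, smul_smul, mul_inv_cancel₀ h2, one_smul]
    simp
  · rw [smul_comm, ← (hrel e f).2.1, smul_smul, inv_mul_cancel₀ h2, one_smul]

/-- The representation of the Heisenberg algebra with given diagonal blocks, off-diagonal block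
and charge. -/
def blockRep (b : LinearMap.BilinForm ℝ E) (a d ρ₁₂ : E →ₗ[ℝ] Module.End ℝ S₀)
    (Z : Module.End ℝ S₀)
    (hZ : ∀ e f, clMul S₀ e * d f - a f * clMul S₀ e = (inner ℝ e f : ℝ) • Z)
    (ha : ∀ e f, a e * a f = a f * a e) (hd : ∀ e f, d e * d f = d f * d e)
    (haZ : ∀ e, Z * d e = a e * Z) (hs : Suitable a d ρ₁₂) :
    Heis b →ₗ⁅ℝ⁆ Module.End ℝ (S₀ × S₀) where
  toFun x := block (a x.vec)
    (√2 • clMul S₀ (opB b (flat.symm x.dual)) + ρ₁₂ x.vec + (x.ctr * √2) • Z) 0 (d x.vec)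
  map_add' x y := by
    rw [block_add, block_inj]
    refine ⟨by simp, ?_, by simp, by simp⟩
    simp only [Heis.dual_add, Heis.vec_add, Heis.ctr_add, map_add, smul_add, add_mul, add_smul]
    abel
  map_smul' t x := by
    rw [RingHom.id_apply, smul_block, block_inj]
    refine ⟨by simp, ?_, by simp, by simp⟩
    simp only [Heis.dual_smul, Heis.vec_smul, Heis.ctr_smul, map_smul]
    module
  map_lie' := by
    intro x y
    rw [Ring.lie_def, block_mul, block_mul, block_sub, block_inj]
    refine ⟨by simp [ha x.vec y.vec], ?_, by simp, by simp [hd x.vec y.vec]⟩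
    have h1 := hZ (opB b (flat.symm x.dual)) y.vec
    have h2 := hZ (opB b (flat.symm y.dual)) x.vec
    have h3 := hs x.vec y.vec
    -- These cancel the contributions of the central coordinates; `h1` and `h2` supply the bracket
    -- value, and `h3` removes the remaining `ρ₁₂` terms.
    have h4 := haZ x.vec
    have h5 := haZ y.vec
    rw [← bilin_eq_inner_opB] at h1 h2
    simp only [Heis.dual_lie, Heis.vec_lie, Heis.ctr_lie, map_zero, smul_zero, zero_add, mul_add,
      add_mul, mul_smul_comm, smul_mul_assoc, h4, h5]
    rw [sub_mul, sub_smul, mul_comm (b _ _), mul_comm (b _ _), mul_smul, mul_smul, ← h1, ← h2]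
    linear_combination (norm := module) -h3

end Representations

end SpinHeis

end

/-! ### The classification theorem -/

open SpinHeis in
theorem theorem2p17 {m : ℕ} (hm : m ≡ 6 [MOD 8])
    {E : Type*} [NormedAddCommGroup E] [InnerProductSpace ℝ E] [FiniteDimensional ℝ E]
    (ε : OrthonormalBasis (Fin m) ℝ E)
    (b : LinearMap.BilinForm ℝ E) (hsymm : b.IsSymm) (hnondeg : b.Nondegenerate)
    {S₀ : Type*} [AddCommGroup S₀] [Module ℝ S₀] [Module (ClE E) S₀]
    [IsScalarTower ℝ (ClE E) S₀] [IsSimpleModule (ClE E) S₀] :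
    Nonempty (ℍ[ℝ] ≃ₐ[ℝ] evenSchur E S₀) ∧
    ∀ Φ : ℍ[ℝ] ≃ₐ[ℝ] evenSchur E S₀,
      (∀ ρ : Heis b →ₗ⁅ℝ⁆ Module.End ℝ (S₀ × S₀), IsSpin ρ → ρ (Heis.p b) ≠ 0 →
        ∃ (h₁ h₂ : ℍ[ℝ]) (h₃ h₄ : E →ₗ[ℝ] ℍ[ℝ]) (ρ₁₂ : E →ₗ[ℝ] Module.End ℝ S₀),
          IsParameter h₁ h₂ h₃ h₄ ∧
          Suitable (rho11 Φ (volumeForm ε) h₁ h₂ h₃ h₄) (rho22 Φ (volumeForm ε) h₁ h₂ h₃ h₄) ρ₁₂ ∧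
          IsGivenBy ρ Φ (volumeForm ε) h₁ h₂ h₃ h₄ ρ₁₂) ∧
      (∀ (h₁ h₂ : ℍ[ℝ]) (h₃ h₄ : E →ₗ[ℝ] ℍ[ℝ]) (ρ₁₂ : E →ₗ[ℝ] Module.End ℝ S₀),
          IsParameter h₁ h₂ h₃ h₄ →
          Suitable (rho11 Φ (volumeForm ε) h₁ h₂ h₃ h₄) (rho22 Φ (volumeForm ε) h₁ h₂ h₃ h₄) ρ₁₂ →
        ∃ ρ : Heis b →ₗ⁅ℝ⁆ Module.End ℝ (S₀ × S₀), IsSpin ρ ∧ ρ (Heis.p b) ≠ 0 ∧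
          IsGivenBy ρ Φ (volumeForm ε) h₁ h₂ h₃ h₄ ρ₁₂) := by
  refine ⟨nonempty_quaternion_equiv_evenSchur hm ε, fun Φ => ?_⟩
  have : Nontrivial S₀ := IsSimpleModule.nontrivial (ClE E) S₀
  have H := isQuaternionicClifford (S₀ := S₀) hm ε Φ
  have hm6 : 6 ≤ m := by
    have hm' : m % 8 = 6 := hm
    omega
  have : Nonempty (Fin m) := ⟨⟨0, by omega⟩⟩
  have h2 : √2 ≠ 0 := by positivity
  constructor
  · intro ρ hspin hcharge
    obtain ⟨a, r, d, Z, hρ, hp, hZ⟩ := hspin.block_relations hnondeg (by omega) ε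
    obtain ⟨h₁, h₂, h₃, h₄, rfl, rfl, rfl⟩ := H.exists_eq_diag ε hZ
    -- The vanishing bracket of two vectors of `E` contains both remaining conditions: commutation
    -- of the upper diagonal blocks and, in the corner, suitability.
    have hlie : ∀ e f, _ := fun e f => congrArg ρ (Heis.lie_ofVec_ofVec (b := b) e f)
    simp only [LieHom.map_lie, map_zero, hρ, Ring.lie_def, block_mul, block_sub, ← block_zero,
      block_inj, mul_zero, add_zero, zero_mul, zero_add] at hlie
    have hsol := H.isQuaternionSolution_of_commute (by omega) ε fun e f =>
      sub_eq_zero.mp (hlie e f).1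
    refine ⟨h₁, h₂, h₃, h₄, r, hsol.isParameter ?_, ?_, hp, hρ⟩
    · by_contra! h0
      refine hcharge ?_
      rw [hp, h0.1, h0.2, cx_zero, block_zero, smul_zero]
    · rw [rho11_eq_diagUpper, rho22_eq_diagLower]
      intro e f
      rw [← sub_eq_zero, ← (hlie e f).2.1]
      abel
  · intro h₁ h₂ h₃ h₄ ρ₁₂ hpar hsuit
    have hsol := hpar.isQuaternionSolution
    rw [rho11_eq_diagUpper, rho22_eq_diagLower] at hsuit
    refine ⟨blockRep b (diagUpper (qAct Φ) (clMul S₀) (cl S₀ (volumeForm ε)) h₁ h₂ h₃ h₄)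
      (diagLower (qAct Φ) (clMul S₀) (cl S₀ (volumeForm ε)) h₁ h₂ h₃ h₄) ρ₁₂
      (cx (qAct Φ) (cl S₀ (volumeForm ε)) h₁ h₂) (H.vec_mul_diagLower_sub h₁ h₂ h₃ h₄)
      (H.lie_diagUpper_eq_zero hsol) (H.lie_diagLower hsol) (H.cx_mul_diagLower hsol) hsuit,
      fun e => ?_, ?_, ?_, fun e => ?_⟩
    · rw [rhoSpin_wedge]
      change block _ _ _ _ = _
      simp [Heis.ofFlat]
    · change block _ _ _ _ ≠ 0
      rw [← block_zero, Ne, block_inj]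
      rintro ⟨-, h, -, -⟩
      simp only [Heis.p, map_zero, smul_zero, zero_add, one_mul] at h
      -- Zero charge would force both `h₁` and `h₂` to vanish, which neither family allows.
      have h0 := H.cx_eq_zero (ε.orthonormal.1 ⟨0, by omega⟩) ((smul_eq_zero_iff_right h2).mp h)
      rcases hpar.ne_zero with h1 | h1
      · exact h1 h0.1
      · exact h1 h0.2
    · change block _ _ _ _ = _
      rw [smul_block, block_inj]
      simp [Heis.p, cx]
    · rw [rho11_eq_diagUpper, rho22_eq_diagLower]
      change block _ _ _ _ = _
      rw [block_inj]
      simp [Heis.ofVec]
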